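/- Let $X$ be a smooth manifold, $G$ a (finite-dimensional, real) Lie group with Lie algebra $\mathfrak g=T_1G$, and $A\in\Omega^1(X,\mathfrak g)$ a smooth $\mathfrak g$-valued 1-form on $X$. A path $\gamma:x\to y$ in $X$ is a smooth map $\gamma:[0,1]\to X$ for which there is $0<\epsilon<\tfrac12$ with $\gamma(t)=x$ for $0\le t<\epsilon$ and $\gamma(t)=y$ for $1-\epsilon<t\le 1$; $PX$ denotes the set of all paths in $X$. Two paths $\gamma_1,\gamma_2:x\to y$ are thin homotopic if there are a smooth map $h:[0,1]\times[0,1]\to X$ and $0<\epsilon<\tfrac12$ such that $h(s,t)=x$ for $0\le t<\epsilon$, $h(s,t)=y$ for $1-\epsilon<t\le1$, $h(s,t)=\gamma_1(t)$ for $0\le s<\epsilon$, $h(s,t)=\gamma_2(t)$ for $1-\epsilon<s\le1$, and the differential of $h$ has rank at most $1$ at every point of $[0,1]\times[0,1]$. This is an equivalence relation on $PX$; let $\mathrm{pr}:PX\to P^1X$ be the projection to the set of equivalence classes. Extend a path $\gamma:x\to y$ to a smooth map $\gamma:\mathbb R\to X$ by $\gamma(t)=x$ for $t<0$ and $\gamma(t)=y$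 for $t>1$. Then the initial value problem $$\frac{\partial}{\partial t}u(t)=-\,\mathrm d r_{u(t)}|_1\Big((\gamma^*A)_t\big(\tfrac{\partial}{\partial t}\big)\Big),\qquad u(0)=1,$$ where $r_g$ denotes right multiplication by $g$ in $G$, has a unique smooth solution $u:\mathbb R\to G$. Define the path-ordered exponential $k_A:PX\to G$ by $k_A(\gamma):=u(1)$. The map $k_A$ factors in a unique way through the set $P^1X$ of thin homotopy classes of paths: there is a unique map $F_A:P^1X\to G$ such that $k_A=F_A\circ\mathrm{pr}$. -/

import Mathlib

open scoped Manifold ContDiff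

/-- A smooth path `[0,1] → X` with sitting instants. -/
structure SittingPath {E : Type*} [NormedAddCommGroup E] [NormedSpace ℝ E]
    {H : Type*} [TopologicalSpace H] (I : ModelWithCorners ℝ E H)
    (X : Type*) [TopologicalSpace X] [ChartedSpace H X] where
  toFun : unitInterval → X
  smooth : ContMDiff (𝓡∂ 1) I ∞ toFun
  sitting : ∃ ε : ℝ, 0 < ε ∧ ε < 1 / 2 ∧
    (∀ t : unitInterval, (t : ℝ) < ε → toFun t = toFun 0) ∧
    (∀ t : unitInterval, 1 - ε < (t : ℝ) → toFun t = toFun 1)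

namespace SittingPath

variable {E : Type*} [NormedAddCommGroup E] [NormedSpace ℝ E]
  {H : Type*} [TopologicalSpace H] {I : ModelWithCorners ℝ E H}
  {X : Type*} [TopologicalSpace X] [ChartedSpace H X]

/-- The extension of a path to `ℝ`, constant on `(-∞, 0]` and on `[1, ∞)`. -/
noncomputable def extend (γ : SittingPath I X) (t : ℝ) : X :=
  γ.toFun (Set.projIcc 0 1 zero_le_one t)

theorem contMDiff_extend (γ : SittingPath I X) : ContMDiff 𝓘(ℝ, ℝ) I ∞ γ.extend := by
  obtain ⟨ε, hε, -, h0, h1⟩ := γ.sitting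
  intro t
  by_cases ht0 : t < ε
  · refine (contMDiffAt_const (c := γ.toFun 0)).congr_of_eventuallyEq ?_
    filter_upwards [Iio_mem_nhds ht0] with r hr
    refine h0 _ ?_
    rw [Set.coe_projIcc]
    exact max_lt hε (lt_of_le_of_lt (min_le_right _ _) hr)
  by_cases ht1 : 1 - ε < t
  · refine (contMDiffAt_const (c := γ.toFun 1)).congr_of_eventuallyEq ?_
    filter_upwards [Ioi_mem_nhds ht1] with r hr
    refine h1 _ ?_
    rw [Set.coe_projIcc]
    exact lt_of_lt_of_le (lt_min (by linarith) hr) (le_max_right _ _)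
  · have hp : ContMDiffAt 𝓘(ℝ, ℝ) (𝓡∂ 1) ∞ (Set.projIcc (0 : ℝ) 1 zero_le_one) t :=
      (contMDiffOn_projIcc t ⟨by linarith, by linarith⟩).contMDiffAt
        (Icc_mem_nhds (by linarith) (by linarith))
    exact γ.smooth.contMDiffAt.comp t hp

/-- `h` is a thin homotopy from `γ₁` to `γ₂`; the arguments of `h` are `(s, t)`, where `t` is the
parameter along the paths and `s` the parameter of the homotopy. -/
structure IsThinHomotopy (γ₁ γ₂ : SittingPath I X) (h : unitInterval × unitInterval → X) :
    Prop where
  smooth : ContMDiff ((𝓡∂ 1).prod (𝓡∂ 1)) I ∞ h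
  sitting : ∃ ε : ℝ, 0 < ε ∧ ε < 1 / 2 ∧
    (∀ s t : unitInterval, (t : ℝ) < ε → h (s, t) = γ₁.toFun 0) ∧
    (∀ s t : unitInterval, 1 - ε < (t : ℝ) → h (s, t) = γ₁.toFun 1) ∧
    (∀ s t : unitInterval, (s : ℝ) < ε → h (s, t) = γ₁.toFun t) ∧
    (∀ s t : unitInterval, 1 - ε < (s : ℝ) → h (s, t) = γ₂.toFun t)
  rank_le_one : ∀ p : unitInterval × unitInterval,
    LinearMap.rank (mfderiv ((𝓡∂ 1).prod (𝓡∂ 1)) I h p).toLinearMap ≤ 1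

/-- Thin homotopy equivalence of two paths with the same end points. -/
def ThinHomotopic (γ₁ γ₂ : SittingPath I X) : Prop :=
  γ₁.toFun 0 = γ₂.toFun 0 ∧ γ₁.toFun 1 = γ₂.toFun 1 ∧
    ∃ h : unitInterval × unitInterval → X, IsThinHomotopy γ₁ γ₂ h

/-- `h` is smooth of rank at most one at `p`. -/
def ThinAt (I : ModelWithCorners ℝ E H) (h : unitInterval × unitInterval → X)
    (p : unitInterval × unitInterval) : Prop :=
  ContMDiffAt ((𝓡∂ 1).prod (𝓡∂ 1)) I ∞ h p ∧
    LinearMap.rank (mfderiv ((𝓡∂ 1).prod (𝓡∂ 1)) I h p).toLinearMap ≤ 1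

theorem ThinAt.congr {h h' : unitInterval × unitInterval → X}
    {p : unitInterval × unitInterval} (hp : ThinAt I h p) (he : h' =ᶠ[nhds p] h) :
    ThinAt I h' p := by
  refine ⟨hp.1.congr_of_eventuallyEq he, ?_⟩
  have h2 := hp.2
  have hq := he.self_of_nhds
  unfold LinearMap.rank at h2 ⊢
  have := he.mfderiv_eq (I := (𝓡∂ 1).prod (𝓡∂ 1)) (I' := I)
  rw [this]
  exact h2

theorem ThinAt.comp {h : unitInterval × unitInterval → X}
    {φ : unitInterval × unitInterval → unitInterval × unitInterval}
    {p : unitInterval × unitInterval} (hp : ThinAt I h (φ p))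
    (hφ : ContMDiffAt ((𝓡∂ 1).prod (𝓡∂ 1)) ((𝓡∂ 1).prod (𝓡∂ 1)) ∞ φ p) :
    ThinAt I (h ∘ φ) p := by
  refine ⟨hp.1.comp p hφ, ?_⟩
  rw [mfderiv_comp p (hp.1.mdifferentiableAt (by simp)) (hφ.mdifferentiableAt (by simp))]
  exact (LinearMap.rank_comp_le_left _ _).trans hp.2

theorem thinAt_snd (γ : SittingPath I X) (p : unitInterval × unitInterval) :
    ThinAt I (fun q : unitInterval × unitInterval ↦ γ.toFun q.2) p := by
  refine ⟨(γ.smooth.comp contMDiff_snd).contMDiffAt, ?_⟩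
  have := mfderiv_comp (I := (𝓡∂ 1).prod (𝓡∂ 1)) (I' := 𝓡∂ 1) (I'' := I) p
    (γ.smooth.contMDiffAt.mdifferentiableAt (x := p.2) (by simp))
    ((contMDiff_snd (n := ∞)).contMDiffAt.mdifferentiableAt (by simp))
  change LinearMap.rank
    (mfderiv ((𝓡∂ 1).prod (𝓡∂ 1)) I (γ.toFun ∘ Prod.snd) p).toLinearMap ≤ 1
  rw [this]
  refine (LinearMap.rank_comp_le_left _ _).trans ?_
  have key : ∀ f : EuclideanSpace ℝ (Fin 1) →ₗ[ℝ] E, LinearMap.rank f ≤ 1 := by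
    intro f
    have hf := LinearMap.finrank_range_le f
    rw [finrank_euclideanSpace_fin] at hf
    rw [LinearMap.rank, ← Module.finrank_eq_rank]
    exact_mod_cast hf
  exact key _

theorem contMDiffAt_reparam {f : ℝ → ℝ} (hf : ContDiff ℝ ∞ f)
    {s : Set unitInterval} (hs : IsOpen s) (hm : ∀ x ∈ s, f x ∈ Set.Icc (0 : ℝ) 1)
    {p : unitInterval × unitInterval} (hp : p.1 ∈ s) :
    ContMDiffAt ((𝓡∂ 1).prod (𝓡∂ 1)) ((𝓡∂ 1).prod (𝓡∂ 1)) ∞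
      (fun q : unitInterval × unitInterval ↦
        ((Set.projIcc (0 : ℝ) 1 zero_le_one (f q.1), q.2) : unitInterval × unitInterval)) p := by
  refine ContMDiffAt.prodMk ?_ contMDiffAt_snd
  have h1 : ContMDiffOn (𝓡∂ 1) (𝓡∂ 1) ∞
      (fun x : unitInterval ↦ Set.projIcc (0 : ℝ) 1 zero_le_one (f x)) s :=
    ContMDiffOn.comp (t := Set.Icc (0 : ℝ) 1) contMDiffOn_projIcc
      ((hf.contMDiff.comp contMDiff_subtypeVal_Icc).contMDiffOn) hm
  exact ContMDiffAt.comp p (h1.contMDiffAt (hs.mem_nhds hp)) contMDiffAt_fst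

theorem thinHomotopic_refl (γ : SittingPath I X) : ThinHomotopic γ γ := by
  obtain ⟨ε, h0, h1, h2, h3⟩ := γ.sitting
  exact ⟨rfl, rfl, fun q ↦ γ.toFun q.2, fun p ↦ (thinAt_snd γ p).1,
    ⟨ε, h0, h1, fun _ t ht ↦ h2 t ht, fun _ t ht ↦ h3 t ht, fun _ _ _ ↦ rfl, fun _ _ _ ↦ rfl⟩,
    fun p ↦ (thinAt_snd γ p).2⟩

theorem ThinHomotopic.symm {γ₁ γ₂ : SittingPath I X} (h : ThinHomotopic γ₁ γ₂) :
    ThinHomotopic γ₂ γ₁ := by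
  obtain ⟨e0, e1, h, hs, ⟨ε, a0, a1, a2, a3, a4, a5⟩, hr⟩ := h
  let φ : unitInterval × unitInterval → unitInterval × unitInterval :=
    fun q ↦ (Set.projIcc (0 : ℝ) 1 zero_le_one (1 - (q.1 : ℝ)), q.2)
  have hc : ∀ x : unitInterval,
      ((Set.projIcc (0 : ℝ) 1 zero_le_one (1 - (x : ℝ)) : unitInterval) : ℝ) = 1 - x := by
    intro x
    rw [Set.projIcc_of_mem zero_le_one (Set.Icc.one_sub_mem x.2)]
  have key : ∀ p, ThinAt I (h ∘ φ) p := fun p ↦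
    ThinAt.comp ⟨hs.contMDiffAt, hr _⟩ (contMDiffAt_reparam (contDiff_const.sub contDiff_id)
      isOpen_univ (fun x _ ↦ Set.Icc.one_sub_mem x.2) (Set.mem_univ _))
  refine ⟨e0.symm, e1.symm, h ∘ φ, fun p ↦ (key p).1, ⟨ε, a0, a1, ?_, ?_, ?_, ?_⟩,
    fun p ↦ (key p).2⟩
  · exact fun s t ht ↦ (a2 _ t ht).trans e0
  · exact fun s t ht ↦ (a3 _ t ht).trans e1
  · exact fun s t ht ↦ a5 _ t (by rw [hc]; linarith)
  · exact fun s t ht ↦ a4 _ t (by rw [hc]; linarith)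

theorem ThinHomotopic.trans {γ₁ γ₂ γ₃ : SittingPath I X} (h : ThinHomotopic γ₁ γ₂)
    (h' : ThinHomotopic γ₂ γ₃) : ThinHomotopic γ₁ γ₃ := by
  obtain ⟨e0, e1, h, hs, ⟨ε, a0, a1, a2, a3, a4, a5⟩, hr⟩ := h
  obtain ⟨e0', e1', h', hs', ⟨ε', a0', a1', a2', a3', a4', a5'⟩, hr'⟩ := h'
  let φ : unitInterval × unitInterval → unitInterval × unitInterval :=
    fun q ↦ (Set.projIcc (0 : ℝ) 1 zero_le_one (2 * (q.1 : ℝ)), q.2)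
  let φ' : unitInterval × unitInterval → unitInterval × unitInterval :=
    fun q ↦ (Set.projIcc (0 : ℝ) 1 zero_le_one (2 * (q.1 : ℝ) - 1), q.2)
  let k : unitInterval × unitInterval → X :=
    fun q ↦ if (q.1 : ℝ) < 1 / 2 then h (φ q) else h' (φ' q)
  have hcont : Continuous fun q : unitInterval × unitInterval ↦ (q.1 : ℝ) :=
    continuous_subtype_val.comp continuous_fst
  have key : ∀ p, ThinAt I k p := by
    intro p
    rcases lt_trichotomy (p.1 : ℝ) (1 / 2) with hp | hp | hp
    · have : ThinAt I (h ∘ φ) p := ThinAt.comp ⟨hs.contMDiffAt, hr _⟩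
        (contMDiffAt_reparam (f := fun x ↦ 2 * x) (contDiff_const.mul contDiff_id)
          (s := {x : unitInterval | (x : ℝ) < 1 / 2})
          (isOpen_lt continuous_subtype_val continuous_const)
          (fun x hx ↦ ⟨by linarith [x.2.1], by linarith [Set.mem_ofPred.1 hx]⟩) hp)
      refine this.congr ?_
      filter_upwards [(isOpen_lt hcont continuous_const).mem_nhds hp] with q hq
      exact if_pos hq
    · refine (thinAt_snd γ₂ p).congr ?_
      have i1 : 1 / 2 - ε / 2 < (p.1 : ℝ) := by linarith
      have i2 : (p.1 : ℝ) < 1 / 2 + ε' / 2 := by linarith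
      filter_upwards [(isOpen_lt hcont continuous_const).mem_nhds i2,
        (isOpen_lt continuous_const hcont).mem_nhds i1] with q hq hq'
      have hq : (q.1 : ℝ) < 1 / 2 + ε' / 2 := hq
      have hq' : 1 / 2 - ε / 2 < (q.1 : ℝ) := hq'
      by_cases hlt : (q.1 : ℝ) < 1 / 2
      · refine (if_pos hlt).trans (a5 _ _ ?_)
        rw [Set.coe_projIcc]
        exact lt_of_lt_of_le (lt_min (by linarith) (by linarith)) (le_max_right _ _)
      · refine (if_neg hlt).trans (a4' _ _ ?_)
        rw [Set.coe_projIcc]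
        exact max_lt a0' (lt_of_le_of_lt (min_le_right _ _) (by linarith))
    · have : ThinAt I (h' ∘ φ') p := ThinAt.comp ⟨hs'.contMDiffAt, hr' _⟩
        (contMDiffAt_reparam (f := fun x ↦ 2 * x - 1)
          ((contDiff_const.mul contDiff_id).sub contDiff_const)
          (s := {x : unitInterval | 1 / 2 < (x : ℝ)})
          (isOpen_lt continuous_const continuous_subtype_val)
          (fun x hx ↦ ⟨by linarith [Set.mem_ofPred.1 hx], by linarith [x.2.2]⟩) hp)
      refine this.congr ?_
      filter_upwards [(isOpen_lt continuous_const hcont).mem_nhds hp] with q hq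
      exact if_neg (not_lt.2 (le_of_lt hq))
  refine ⟨e0.trans e0', e1.trans e1', k, fun p ↦ (key p).1,
    ⟨min ε ε' / 2, by positivity, ?_, ?_, ?_, ?_, ?_⟩, fun p ↦ (key p).2⟩
  · linarith [min_le_left ε ε']
  · intro s t ht
    by_cases hlt : (s : ℝ) < 1 / 2
    · exact (if_pos hlt).trans (a2 _ _ (by linarith [min_le_left ε ε']))
    · exact (if_neg hlt).trans ((a2' _ _ (by linarith [min_le_right ε ε'])).trans e0.symm)
  · intro s t ht
    by_cases hlt : (s : ℝ) < 1 / 2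
    · exact (if_pos hlt).trans (a3 _ _ (by linarith [min_le_left ε ε']))
    · exact (if_neg hlt).trans ((a3' _ _ (by linarith [min_le_right ε ε'])).trans e1.symm)
  · intro s t hst
    have hlt : (s : ℝ) < 1 / 2 := by linarith [min_le_left ε ε']
    refine (if_pos hlt).trans (a4 _ _ ?_)
    rw [Set.coe_projIcc]
    exact max_lt a0 (lt_of_le_of_lt (min_le_right _ _) (by linarith [min_le_left ε ε']))
  · intro s t hst
    have hlt : ¬ (s : ℝ) < 1 / 2 := by linarith [min_le_left ε ε']
    refine (if_neg hlt).trans (a5' _ _ ?_)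
    rw [Set.coe_projIcc]
    exact lt_of_lt_of_le (lt_min (by linarith) (by linarith [min_le_right ε ε']))
      (le_max_right _ _)

/-- Thin homotopy is an equivalence relation on paths. -/
def thinSetoid (I : ModelWithCorners ℝ E H) (X : Type*) [TopologicalSpace X]
    [ChartedSpace H X] : Setoid (SittingPath I X) where
  r := ThinHomotopic
  iseqv := ⟨thinHomotopic_refl, ThinHomotopic.symm, ThinHomotopic.trans⟩

end SittingPath

/-- The set of thin homotopy classes of paths in `X`. -/
def ThinPathClass {E : Type*} [NormedAddCommGroup E] [NormedSpace ℝ E]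
    {H : Type*} [TopologicalSpace H] (I : ModelWithCorners ℝ E H)
    (X : Type*) [TopologicalSpace X] [ChartedSpace H X] : Type _ :=
  Quotient (SittingPath.thinSetoid I X)

/-- The projection of a path to its thin homotopy class. -/
def SittingPath.pr {E : Type*} [NormedAddCommGroup E] [NormedSpace ℝ E]
    {H : Type*} [TopologicalSpace H] {I : ModelWithCorners ℝ E H}
    {X : Type*} [TopologicalSpace X] [ChartedSpace H X] (γ : SittingPath I X) :
    ThinPathClass I X :=
  Quotient.mk _ γ

/-- A smooth 1-form on `X` with values in the Lie algebra `T₁G` of `G`: a family of linear maps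
`T_xX → T₁G` that is smooth as a map `TX → T₁G`. -/
structure LieOneForm {E : Type*} [NormedAddCommGroup E] [NormedSpace ℝ E]
    {H : Type*} [TopologicalSpace H] (I : ModelWithCorners ℝ E H)
    (X : Type*) [TopologicalSpace X] [ChartedSpace H X] [IsManifold I ∞ X]
    {E' : Type*} [NormedAddCommGroup E'] [NormedSpace ℝ E']
    {H' : Type*} [TopologicalSpace H'] (J : ModelWithCorners ℝ E' H')
    (G : Type*) [TopologicalSpace G] [ChartedSpace H' G] [Group G] where
  toFun : ∀ x : X, TangentSpace I x →L[ℝ] GroupLieAlgebra J G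
  smooth : ContMDiff (M' := E') I.tangent 𝓘(ℝ, E') ∞
    (fun v : TangentBundle I X ↦ toFun v.proj v.snd)

section PathOrderedExponential

variable {E : Type*} [NormedAddCommGroup E] [NormedSpace ℝ E]
  {H : Type*} [TopologicalSpace H] {I : ModelWithCorners ℝ E H}
  {X : Type*} [TopologicalSpace X] [ChartedSpace H X] [IsManifold I ∞ X]
  {E' : Type*} [NormedAddCommGroup E'] [NormedSpace ℝ E']
  {H' : Type*} [TopologicalSpace H'] {J : ModelWithCorners ℝ E' H'}
  {G : Type*} [TopologicalSpace G] [ChartedSpace H' G] [Group G]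

/-- The pullback `c^*A` of a 1-form along a smooth curve `c : ℝ → X`. -/
noncomputable def LieOneForm.pullback (A : LieOneForm I X J G) (c : ℝ → X)
    (hc : ContMDiff 𝓘(ℝ, ℝ) I ∞ c) : LieOneForm 𝓘(ℝ, ℝ) ℝ J G where
  toFun t := (A.toFun (c t)).comp (mfderiv 𝓘(ℝ, ℝ) I c t)
  smooth := A.smooth.comp (hc.contMDiff_tangentMap (m := ∞) (by simp))

/-- `u` is a smooth solution of the initial value problem
`∂u/∂t (t) = - dr_{u(t)}|₁ (B_t(∂/∂t))`, `u(t₀) = 1`, where `r_g` is right multiplication by `g`. -/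
structure IsPathOrderedSolution (B : LieOneForm 𝓘(ℝ, ℝ) ℝ J G) (t₀ : ℝ) (u : ℝ → G) : Prop where
  smooth : ContMDiff 𝓘(ℝ, ℝ) J ∞ u
  deriv : ∀ t : ℝ, (mfderiv 𝓘(ℝ, ℝ) J u t (1 : ℝ) : E') =
    -(mfderiv J J (fun g : G ↦ g * u t) 1 (B.toFun t (1 : ℝ)) : E')
  initial : u t₀ = 1

open Classical in
/-- The path-ordered exponential `f_B(t₀, t)` of a Lie algebra valued 1-form `B` on `ℝ`: the value
at `t` of the solution of the initial value problem with `u(t₀) = 1`. -/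
noncomputable def pathOrderedExp (B : LieOneForm 𝓘(ℝ, ℝ) ℝ J G) (t₀ t : ℝ) : G :=
  if h : ∃ u : ℝ → G, IsPathOrderedSolution B t₀ u then h.choose t else 1

/-- The map `k_A : PX → G`, `γ ↦ f_{γ^*A}(0, 1)`. -/
noncomputable def pathHolonomy (A : LieOneForm I X J G) (γ : SittingPath I X) : G :=
  pathOrderedExp (A.pullback γ.extend γ.contMDiff_extend) 0 1

end PathOrderedExponential

/-! Pull `A` back along the extended homotopy f : ℝ × ℝ → X and write f^*A = a ds + B dt. Since df
has rank at most one, ∂ₛf and ∂ₜf are multiples of one vector. Hence the 2-form f^*(dA) vanishes, so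
∂ₜa = ∂ₛB (`LieOneForm.fderiv_component_symm`), and a, B are pointwise parallel in the Lie algebra,
so their bracket vanishes: f^*A is flat. The sitting instants give a = 0 at t = 0 and t = 1. If u_s
solves u' = -dr_u(B(s, ·)) with u_s(0) = 1, flatness should make u_s(1) independent of s, and s = 0,
1 give the two holonomies.

The independence is proved without smooth dependence of u_s on s. In the chart at 1, with e the
image of 1, the ratio u_{s₀+σ} u_{s₀}⁻¹ solves y' = -R(y) B(s₀+σ, t) + L(y) B(s₀, t), where R and L
are the derivatives at 1 of right and left translation. The curve e - σ a(s₀, t) solves this up to a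
defect that is o(σ) uniformly in t (`eventually_norm_defect_le`): the terms of order σ are ∂ₛB - ∂ₜa
and a commutator. Grönwall's inequality (`dist_le_of_trapped`) and a(s₀, 1) = 0 then place the ratio
at t = 1 within o(σ) of e. So s ↦ u_s(1) has zero velocity everywhere and is constant
(`right_solution_eq_of_flat`).

Global solutions exist because the equation is right-invariant and its coefficient vanishes outside
[0, 1]: local solutions live for a time independent of the starting point (`exists_right_solution`).
-/

section

open Filter Topology Set
open scoped NNReal

/-! ### Second derivatives of a local multiplication. -/

section LocalGroup

variable {F : Type*} [NormedAddCommGroup F] [NormedSpace ℝ F]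

theorem contDiffAt_fderiv_left {μ : F × F → F} {e : F} (hμ : ContDiffAt ℝ ∞ μ (e, e)) :
    ContDiffAt ℝ ∞ (fun y ↦ fderiv ℝ (fun x ↦ μ (x, y)) e) e := by
  have h : ContDiffAt ℝ ∞ (Function.uncurry fun y x ↦ μ (x, y)) (e, e) :=
    hμ.comp (e, e) (contDiffAt_snd.prodMk contDiffAt_fst)
  exact h.fderiv contDiffAt_const (by simp)

theorem contDiffAt_fderiv_right {μ : F × F → F} {e : F} (hμ : ContDiffAt ℝ ∞ μ (e, e)) :
    ContDiffAt ℝ ∞ (fun y ↦ fderiv ℝ (fun x ↦ μ (y, x)) e) e := by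
  have h : ContDiffAt ℝ ∞ (Function.uncurry fun y x ↦ μ (y, x)) (e, e) := hμ
  exact h.fderiv contDiffAt_const (by simp)

/-- Both sides are the mixed second partial of `μ` at `(e, e)`, taken in the two orders, so this is
symmetry of the second derivative. For a group law it expresses [x, x] = 0. -/
theorem fderiv_fderiv_left_eq_right {μ : F × F → F} {e : F} (hμ : ContDiffAt ℝ ∞ μ (e, e))
    (x : F) :
    fderiv ℝ (fun y ↦ fderiv ℝ (fun x ↦ μ (x, y)) e) e x x =
      fderiv ℝ (fun y ↦ fderiv ℝ (fun x ↦ μ (y, x)) e) e x x := by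
  have hd : ∀ᶠ p in 𝓝 (e, e), DifferentiableAt ℝ μ p := by
    filter_upwards [(hμ.of_le (m := 1) (by simp)).eventually (by simp)] with p hp
    exact hp.differentiableAt (by simp)
  have hd2 : DifferentiableAt ℝ (fderiv ℝ μ) (e, e) :=
    (hμ.fderiv_right (m := 1) (by norm_cast)).differentiableAt (by simp)
  have c1 : Tendsto (fun y : F ↦ (e, y)) (𝓝 e) (𝓝 (e, e)) :=
    (Continuous.prodMk_right e).tendsto' _ _ rfl
  have c2 : Tendsto (fun y : F ↦ (y, e)) (𝓝 e) (𝓝 (e, e)) :=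
    (Continuous.prodMk_left e).tendsto' _ _ rfl
  have e1 : (fun y ↦ fderiv ℝ (fun x ↦ μ (x, y)) e) =ᶠ[𝓝 e]
      fun y ↦ (fderiv ℝ μ (e, y)).comp (ContinuousLinearMap.inl ℝ F F) := by
    filter_upwards [c1.eventually hd] with y hy
    exact (hy.hasFDerivAt.comp e (hasFDerivAt_prodMk_left e y)).fderiv
  have e2 : (fun y ↦ fderiv ℝ (fun x ↦ μ (y, x)) e) =ᶠ[𝓝 e]
      fun y ↦ (fderiv ℝ μ (y, e)).comp (ContinuousLinearMap.inr ℝ F F) := by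
    filter_upwards [c2.eventually hd] with y hy
    exact (hy.hasFDerivAt.comp e (hasFDerivAt_prodMk_right y e)).fderiv
  have f1 : HasFDerivAt (fun y ↦ (fderiv ℝ μ (e, y)).comp (ContinuousLinearMap.inl ℝ F F)) _ e :=
    (hd2.hasFDerivAt.comp e (hasFDerivAt_prodMk_right e e)).clm_comp (hasFDerivAt_const _ _)
  have f2 : HasFDerivAt (fun y ↦ (fderiv ℝ μ (y, e)).comp (ContinuousLinearMap.inr ℝ F F)) _ e :=
    (HasFDerivAt.comp (g := fderiv ℝ μ) (f := fun y ↦ (y, e)) e hd2.hasFDerivAt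
      (hasFDerivAt_prodMk_left e e)).clm_comp (hasFDerivAt_const _ _)
  rw [e1.fderiv_eq, e2.fderiv_eq, f1.fderiv, f2.fderiv]
  have hs := hμ.isSymmSndFDerivAt (by simp; norm_cast)
  simpa using hs (0, x) (x, 0)

end LocalGroup

/-! ### Uniform first-order estimates. -/

section Analysis

variable {F : Type*} [NormedAddCommGroup F] [NormedSpace ℝ F]

/-- A `C¹` function vanishing to first order in the first variable along `{0} × K` is uniformly
`o(σ)` for `K` compact. -/
theorem eventually_norm_le_of_deriv_zero {Q : ℝ × ℝ → F} {K : Set ℝ} (hK : IsCompact K)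
    (hQ : ∀ t ∈ K, ContDiffAt ℝ 1 Q (0, t)) (h0 : ∀ t ∈ K, Q (0, t) = 0)
    (h1 : ∀ t ∈ K, fderiv ℝ Q (0, t) (1, 0) = 0) {ε : ℝ} (hε : 0 < ε) :
    ∀ᶠ σ in 𝓝 (0 : ℝ), ∀ t ∈ K, ‖Q (σ, t)‖ ≤ ε * |σ| := by
  refine hK.eventually_forall_of_forall_eventually
    (P := fun σ t ↦ t ∈ K → ‖Q (σ, t)‖ ≤ ε * |σ|) (fun t ht ↦ ?_) |>.mono
    fun σ h t ht ↦ h t ht ht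
  -- Strict differentiability compares (σ, t') with (0, t') for all t' near t at once. Their
  -- difference is a multiple of (1, 0), which the derivative kills; compactness of `K` does the
  -- rest.
  have hs := ((hQ t ht).hasStrictFDerivAt (by simp)).isLittleO.def hε
  have hc : Tendsto (fun p : ℝ × ℝ ↦ (p, ((0 : ℝ), p.2))) (𝓝 (0, t))
      (𝓝 (((0 : ℝ), t), ((0 : ℝ), t))) :=
    Continuous.tendsto' (by fun_prop) _ _ rfl
  filter_upwards [hc.eventually hs] with p hp hpK
  have e1 : p - (0, p.2) = p.1 • ((1 : ℝ), (0 : ℝ)) := by ext <;> simp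
  simp only [e1, map_smul, h1 t ht, h0 p.2 hpK] at hp
  simpa [norm_smul] using hp

/-- The defect of the approximate solution `e - σ a(s₀, ·)` of `y' = -R(y) B(s₀ + σ) + N(y) B(s₀)` is
uniformly `o(σ)` when `∂ₜa = ∂ₛB` and the commutator of `a` and `B` vanishes. -/
theorem eventually_norm_defect_le {R N : F → F →L[ℝ] F} {e : F} (hR : ContDiffAt ℝ ∞ R e)
    (hN : ContDiffAt ℝ ∞ N e) (hRe : R e = ContinuousLinearMap.id ℝ F)
    (hNe : N e = ContinuousLinearMap.id ℝ F) {a B : ℝ × ℝ → F} (ha : ContDiff ℝ ∞ a)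
    (hB : ContDiff ℝ ∞ B) {s₀ : ℝ} {K : Set ℝ} (hK : IsCompact K)
    (hflat : ∀ t ∈ K, fderiv ℝ a (s₀, t) (0, 1) = fderiv ℝ B (s₀, t) (1, 0))
    (hcomm : ∀ t ∈ K, fderiv ℝ R e (a (s₀, t)) (B (s₀, t)) = fderiv ℝ N e (a (s₀, t)) (B (s₀, t)))
    {ε : ℝ} (hε : 0 < ε) :
    ∀ᶠ σ in 𝓝 (0 : ℝ), ∀ t ∈ K, ‖-(σ • fderiv ℝ a (s₀, t) (0, 1)) -
      (-R (e - σ • a (s₀, t)) (B (s₀ + σ, t)) + N (e - σ • a (s₀, t)) (B (s₀, t)))‖ ≤ ε * |σ| := by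
  have hca : ContDiff ℝ ∞ fun p : ℝ × ℝ ↦ fderiv ℝ a (s₀, p.2) (0, 1) :=
    ((ha.fderiv_right (m := ∞) (by simp)).comp (contDiff_const.prodMk contDiff_snd)).clm_apply
      contDiff_const
  have hy : ContDiff ℝ ∞ fun p : ℝ × ℝ ↦ e - p.1 • a (s₀, p.2) :=
    contDiff_const.sub (contDiff_fst.smul (ha.comp (contDiff_const.prodMk contDiff_snd)))
  have hB1 : ContDiff ℝ ∞ fun p : ℝ × ℝ ↦ B (s₀ + p.1, p.2) :=
    hB.comp ((contDiff_const.add contDiff_fst).prodMk contDiff_snd)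
  have hB0 : ContDiff ℝ ∞ fun p : ℝ × ℝ ↦ B (s₀, p.2) :=
    hB.comp (contDiff_const.prodMk contDiff_snd)
  have hQ : ∀ t ∈ K, ContDiffAt ℝ ∞ (fun p : ℝ × ℝ ↦ -(p.1 • fderiv ℝ a (s₀, p.2) (0, 1)) -
      (-R (e - p.1 • a (s₀, p.2)) (B (s₀ + p.1, p.2)) +
        N (e - p.1 • a (s₀, p.2)) (B (s₀, p.2)))) (0, t) := by
    intro t _
    have hR' : ContDiffAt ℝ ∞ (fun p : ℝ × ℝ ↦ R (e - p.1 • a (s₀, p.2))) (0, t) :=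
      ContDiffAt.comp (g := R) (0, t) (by simpa using hR) hy.contDiffAt
    have hN' : ContDiffAt ℝ ∞ (fun p : ℝ × ℝ ↦ N (e - p.1 • a (s₀, p.2))) (0, t) :=
      ContDiffAt.comp (g := N) (0, t) (by simpa using hN) hy.contDiffAt
    exact (contDiff_fst.smul hca).neg.contDiffAt.sub
      ((hR'.clm_apply hB1.contDiffAt).neg.add (hN'.clm_apply hB0.contDiffAt))
  refine eventually_norm_le_of_deriv_zero hK (fun t ht ↦ (hQ t ht).of_le (by simp)) ?_ ?_ hε
  · intro t _
    simp [hRe, hNe]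
  · intro t ht
    have hd := ((hQ t ht).differentiableAt (by simp)).hasFDerivAt
    have hl : HasDerivAt (fun σ : ℝ ↦ (σ, t)) ((1 : ℝ), (0 : ℝ)) 0 :=
      (hasDerivAt_id _).prodMk (hasDerivAt_const _ _)
    -- The derivative along σ ↦ (σ, t) is -∂ₜa + ∂ₛB - DR(a)B + DN(a)B, which cancels by `hflat` and
    -- `hcomm`.
    refine (hd.comp_hasDerivAt (0 : ℝ) hl).unique ?_
    have h1 : HasDerivAt (fun σ : ℝ ↦ e - σ • a (s₀, t)) (-a (s₀, t)) 0 := by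
      simpa using ((hasDerivAt_id (0 : ℝ)).smul_const (a (s₀, t))).const_sub e
    have hR1 : HasDerivAt (fun σ : ℝ ↦ R (e - σ • a (s₀, t))) (fderiv ℝ R e (-a (s₀, t))) 0 :=
      HasFDerivAt.comp_hasDerivAt (l := R) (0 : ℝ)
        (by simpa using (hR.differentiableAt (by simp)).hasFDerivAt) h1
    have hN1 : HasDerivAt (fun σ : ℝ ↦ N (e - σ • a (s₀, t))) (fderiv ℝ N e (-a (s₀, t))) 0 :=
      HasFDerivAt.comp_hasDerivAt (l := N) (0 : ℝ)
        (by simpa using (hN.differentiableAt (by simp)).hasFDerivAt) h1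
    have h2 : HasDerivAt (fun σ : ℝ ↦ (s₀ + σ, t)) ((1 : ℝ), (0 : ℝ)) 0 :=
      ((hasDerivAt_id _).const_add _).prodMk (hasDerivAt_const _ _)
    have hB2 : HasDerivAt (fun σ : ℝ ↦ B (s₀ + σ, t)) (fderiv ℝ B (s₀, t) (1, 0)) 0 :=
      HasFDerivAt.comp_hasDerivAt (l := B) (0 : ℝ)
        (by simpa using (hB.differentiable (by simp) (s₀, t)).hasFDerivAt) h2
    have := ((hasDerivAt_id (0 : ℝ)).smul_const (fderiv ℝ a (s₀, t) (0, 1))).neg.sub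
      ((hR1.clm_apply hB2).neg.add (hN1.clm_apply (hasDerivAt_const (0 : ℝ) (B (s₀, t)))))
    convert! this using 1
    simp [hRe, hNe, hflat t ht, hcomm t ht]

end Analysis

/-! ### Derivatives and velocities with values in the model spaces. -/

section Pushforward

variable {E : Type*} [NormedAddCommGroup E] [NormedSpace ℝ E]
  {H : Type*} [TopologicalSpace H] {I : ModelWithCorners ℝ E H}
  {M : Type*} [TopologicalSpace M] [ChartedSpace H M]
  {E' : Type*} [NormedAddCommGroup E'] [NormedSpace ℝ E']
  {H' : Type*} [TopologicalSpace H'] {J : ModelWithCorners ℝ E' H'}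
  {N : Type*} [TopologicalSpace N] [ChartedSpace H' N]
  {E'' : Type*} [NormedAddCommGroup E''] [NormedSpace ℝ E'']
  {H'' : Type*} [TopologicalSpace H''] {K : ModelWithCorners ℝ E'' H''}
  {P : Type*} [TopologicalSpace P] [ChartedSpace H'' P]

/-- The derivative of a map of manifolds, as a linear map between the model spaces. -/
noncomputable def pushforward (I : ModelWithCorners ℝ E H) (J : ModelWithCorners ℝ E' H')
    (f : M → N) (x : M) : E →L[ℝ] E' :=
  mfderiv I J f x

/-- The curve `u` has velocity `v` at time `t`. -/
def HasVelocityAt (I : ModelWithCorners ℝ E H) (u : ℝ → M) (v : E) (t : ℝ) : Prop :=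
  HasMFDerivAt 𝓘(ℝ, ℝ) I u t (ContinuousLinearMap.smulRight (1 : ℝ →L[ℝ] ℝ) v : ℝ →L[ℝ] E)

theorem pushforward_comp {g : N → P} {f : M → N} (x : M) (hg : MDifferentiableAt J K g (f x))
    (hf : MDifferentiableAt I J f x) (v : E) :
    pushforward I K (g ∘ f) x v = pushforward J K g (f x) (pushforward I J f x v) :=
  congrArg (fun L : E →L[ℝ] E'' ↦ L v) (mfderiv_comp x hg hf)

theorem pushforward_id (x : M) (v : E) : pushforward I I (id : M → M) x v = v :=
  congrArg (fun L : E →L[ℝ] E ↦ L v) (mfderiv_id (x := x))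

theorem pushforward_const (c : N) (x : M) (v : E) :
    pushforward I J (fun _ : M ↦ c) x v = 0 :=
  congrArg (fun L : E →L[ℝ] E' ↦ L v) (mfderiv_const (x := x))

theorem pushforward_congr {f g : M → N} {x : M} (h : f =ᶠ[𝓝 x] g) :
    pushforward I J f x = pushforward I J g x :=
  h.mfderiv_eq

theorem pushforward_eq_fderiv {f : E → E'} (x : E) :
    pushforward 𝓘(ℝ, E) 𝓘(ℝ, E') f x = fderiv ℝ f x :=
  mfderiv_eq_fderiv

theorem pushforward_prod {f : M × N → P} {x : M} {y : N}
    (hf : MDifferentiableAt (I.prod J) K f (x, y)) (v : E) (w : E') :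
    pushforward (I.prod J) K f (x, y) (v, w) =
      pushforward I K (fun z ↦ f (z, y)) x v + pushforward J K (fun z ↦ f (x, z)) y w :=
  mfderiv_prod_eq_add_apply hf

theorem HasVelocityAt.comp {f : M → N} {u : ℝ → M} {v : E} {t : ℝ} (hu : HasVelocityAt I u v t)
    (hf : MDifferentiableAt I J f (u t)) :
    HasVelocityAt J (fun t ↦ f (u t)) (pushforward I J f (u t) v) t := by
  refine (hf.hasMFDerivAt.comp t hu).congr_mfderiv ?_
  refine ContinuousLinearMap.ext_ring ?_
  change pushforward I J f (u t) ((1 : ℝ) • v) = (1 : ℝ) • pushforward I J f (u t) v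
  simp

theorem HasVelocityAt.prodMk {u : ℝ → M} {u' : ℝ → N} {v : E} {v' : E'} {t : ℝ}
    (hu : HasVelocityAt I u v t) (hu' : HasVelocityAt J u' v' t) :
    HasVelocityAt (I.prod J) (fun t ↦ (u t, u' t)) (v, v') t := by
  refine (HasMFDerivAt.prodMk hu hu').congr_mfderiv ?_
  refine ContinuousLinearMap.ext_ring ?_
  rfl

theorem hasVelocityAt_iff_hasDerivAt {u : ℝ → E} {v : E} {t : ℝ} :
    HasVelocityAt 𝓘(ℝ, E) u v t ↔ HasDerivAt u v t := by
  unfold HasVelocityAt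
  exact hasMFDerivAt_iff_hasFDerivAt

theorem HasVelocityAt.congr_of_eventuallyEq {u u' : ℝ → M} {v : E} {t : ℝ}
    (hu : HasVelocityAt I u v t) (h : u' =ᶠ[𝓝 t] u) : HasVelocityAt I u' v t :=
  HasMFDerivAt.congr_of_eventuallyEq hu h

theorem HasVelocityAt.continuousAt {u : ℝ → M} {v : E} {t : ℝ}
    (hu : HasVelocityAt I u v t) : ContinuousAt u t :=
  HasMFDerivAt.continuousAt hu

theorem HasVelocityAt.pushforward_one {u : ℝ → M} {v : E} {t : ℝ}
    (hu : HasVelocityAt I u v t) : pushforward 𝓘(ℝ, ℝ) I u t 1 = v := by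
  have : pushforward 𝓘(ℝ, ℝ) I u t = (1 : ℝ →L[ℝ] ℝ).smulRight v := HasMFDerivAt.mfderiv hu
  simp [this]

theorem hasVelocityAt_pushforward {u : ℝ → M} {t : ℝ} (hu : MDifferentiableAt 𝓘(ℝ, ℝ) I u t) :
    HasVelocityAt I u (pushforward 𝓘(ℝ, ℝ) I u t 1) t := by
  refine hu.hasMFDerivAt.congr_mfderiv ?_
  refine ContinuousLinearMap.ext_ring ?_
  exact (one_smul ℝ (pushforward 𝓘(ℝ, ℝ) I u t 1)).symm

end Pushforward

/-! ### The right-invariant equation on a Lie group. -/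

section LieGroup

variable {E' : Type*} [NormedAddCommGroup E'] [NormedSpace ℝ E']
  {H' : Type*} [TopologicalSpace H'] {J : ModelWithCorners ℝ E' H'}
  {G : Type*} [TopologicalSpace G] [ChartedSpace H' G] [Group G]

/-- `u` satisfies `u' = -dr_u(b)` at time `t`. -/
def IsRightSolutionAt (J : ModelWithCorners ℝ E' H') (b : ℝ → E') (u : ℝ → G) (t : ℝ) : Prop :=
  HasVelocityAt J u (-pushforward J J (fun g : G ↦ g * u t) 1 (b t)) t

variable [LieGroup J ∞ G]

theorem mdifferentiableAt_mul_right_const (g x : G) :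
    MDifferentiableAt J J (fun y : G ↦ y * g) x :=
  (contMDiff_mul_right (I := J) (n := ∞) (a := g)).mdifferentiableAt (by simp)

theorem mdifferentiableAt_mul_left_const (g x : G) :
    MDifferentiableAt J J (fun y : G ↦ g * y) x :=
  (contMDiff_mul_left (I := J) (n := ∞) (a := g)).mdifferentiableAt (by simp)

theorem mdifferentiableAt_group_inv (x : G) : MDifferentiableAt J J (fun y : G ↦ y⁻¹) x :=
  (contMDiff_inv J ∞).mdifferentiableAt (by simp)

theorem mdifferentiableAt_group_mul (p : G × G) :
    MDifferentiableAt (J.prod J) J (fun p : G × G ↦ p.1 * p.2) p :=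
  (contMDiff_mul J ∞).mdifferentiableAt (by simp)

theorem mdifferentiableAt_mul_inv (p : G × G) :
    MDifferentiableAt (J.prod J) J (fun p : G × G ↦ p.1 * p.2⁻¹) p :=
  (contMDiff_fst.mul (contMDiff_snd.inv)).mdifferentiableAt (n := ∞) (by simp)

/-- Right translations compose, r_g ∘ r_u = r_{ug}, so the equation is invariant under them. -/
theorem IsRightSolutionAt.mul_const {b : ℝ → E'} {u : ℝ → G} {t : ℝ}
    (h : IsRightSolutionAt J b u t) (g : G) : IsRightSolutionAt J b (fun t ↦ u t * g) t := by
  have h1 := HasVelocityAt.comp h (mdifferentiableAt_mul_right_const (J := J) g (u t))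
  unfold IsRightSolutionAt
  convert! h1 using 1
  have h2 := pushforward_comp (1 : G)
    (mdifferentiableAt_mul_right_const (J := J) g (1 * u t))
    (mdifferentiableAt_mul_right_const (J := J) (u t) 1) (b t)
  rw [one_mul] at h2
  rw [map_neg, ← h2]
  congr! 4
  simp [mul_assoc]

/-- Differentiate g · g⁻¹ = 1 at 1. -/
theorem pushforward_inv_one (v : E') : pushforward J J (fun g : G ↦ g⁻¹) 1 v = -v := by
  have h1 : MDifferentiableAt J (J.prod J) (fun g : G ↦ (g, g⁻¹)) 1 :=
    mdifferentiableAt_id.prodMk (mdifferentiableAt_group_inv 1)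
  have h2 := pushforward_comp (1 : G) (mdifferentiableAt_group_mul (J := J) _) h1 v
  have h3 : ((fun p : G × G ↦ p.1 * p.2) ∘ fun g : G ↦ (g, g⁻¹)) = fun _ ↦ 1 := by
    ext g; simp
  have h4 : pushforward J (J.prod J) (fun g : G ↦ (g, g⁻¹)) 1 v =
      (v, pushforward J J (fun g : G ↦ g⁻¹) 1 v) :=
    congrArg (fun L : E' →L[ℝ] E' × E' ↦ L v)
      (HasMFDerivAt.mfderiv ((hasMFDerivAt_id (I := J) (1 : G)).prodMk
        (mdifferentiableAt_group_inv (J := J) (1 : G)).hasMFDerivAt))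
  rw [h3, pushforward_const, h4, pushforward_prod (mdifferentiableAt_group_mul _)] at h2
  have h5 := pushforward_id (I := J) (1 : G)
  simp only [Function.id_def] at h5
  simp only [inv_one, mul_one, one_mul, h5] at h2
  exact (neg_eq_of_add_eq_zero_right h2.symm).symm

/-- Multiplying both curves on the right by the constant u₂(t)⁻¹ leaves the ratio unchanged and
moves the base point to (w, 1). There inversion has derivative -1, which turns the second velocity
into a left translate. -/
theorem IsRightSolutionAt.hasDerivAt_mul_inv {b₁ b₂ : ℝ → E'} {u₁ u₂ : ℝ → G} {t : ℝ}
    (h₁ : IsRightSolutionAt J b₁ u₁ t) (h₂ : IsRightSolutionAt J b₂ u₂ t) {φ : G → E'}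
    (hφ : MDifferentiableAt J 𝓘(ℝ, E') φ (u₁ t * (u₂ t)⁻¹)) :
    HasDerivAt (fun t ↦ φ (u₁ t * (u₂ t)⁻¹))
      (-pushforward J 𝓘(ℝ, E') (fun x ↦ φ (x * (u₁ t * (u₂ t)⁻¹))) 1 (b₁ t) +
        pushforward J 𝓘(ℝ, E') (fun x ↦ φ (u₁ t * (u₂ t)⁻¹ * x)) 1 (b₂ t)) t := by
  set w := u₁ t * (u₂ t)⁻¹ with hw
  have k₁ := h₁.mul_const (u₂ t)⁻¹
  have k₂ := h₂.mul_const (u₂ t)⁻¹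
  unfold IsRightSolutionAt at k₁ k₂
  simp only [mul_inv_cancel, mul_one, ← hw] at k₁ k₂
  have h5 := pushforward_id (I := J) (1 : G)
  simp only [Function.id_def] at h5
  rw [h5] at k₂
  have hf : MDifferentiableAt (J.prod J) 𝓘(ℝ, E') (fun p : G × G ↦ φ (p.1 * p.2⁻¹))
      (w, 1) :=
    MDifferentiableAt.comp (g := φ) (w, 1) (by simpa using hφ) (mdifferentiableAt_mul_inv _)
  have hf' : MDifferentiableAt (J.prod J) 𝓘(ℝ, E') (fun p : G × G ↦ φ (p.1 * p.2⁻¹))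
      (u₁ t * (u₂ t)⁻¹, u₂ t * (u₂ t)⁻¹) := by rwa [mul_inv_cancel]
  have k := (k₁.prodMk k₂).comp hf'
  rw [hasVelocityAt_iff_hasDerivAt, mul_inv_cancel, pushforward_prod hf] at k
  convert! k using 1
  · ext t; simp
  have e1 : pushforward J 𝓘(ℝ, E') (fun x ↦ φ (x * w)) 1 (b₁ t) =
      pushforward J 𝓘(ℝ, E') φ w (pushforward J J (fun x ↦ x * w) 1 (b₁ t)) := by
    have := pushforward_comp (g := φ) (1 : G) (by simpa using hφ)
      (mdifferentiableAt_mul_right_const (J := J) w 1) (b₁ t)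
    rw [one_mul] at this
    exact this
  have e2 : pushforward J 𝓘(ℝ, E') (fun z ↦ φ (w * z⁻¹)) 1 (-b₂ t) =
      pushforward J 𝓘(ℝ, E') (fun x ↦ φ (w * x)) 1 (b₂ t) := by
    have hg : MDifferentiableAt J 𝓘(ℝ, E') (fun x ↦ φ (w * x)) ((1 : G)⁻¹) :=
      MDifferentiableAt.comp (g := φ) _ (by simpa using hφ) (mdifferentiableAt_mul_left_const _ _)
    have := pushforward_comp (1 : G) hg (mdifferentiableAt_group_inv (J := J) 1) (-b₂ t)
    rw [pushforward_inv_one, neg_neg, inv_one] at this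
    exact this
  simp only [inv_one, mul_one]
  rw [e1, e2, map_neg]

end LieGroup

/-! ### The group law in the chart at the identity. -/

section GroupChart

variable {E' : Type*} [NormedAddCommGroup E'] [NormedSpace ℝ E']
  {H' : Type*} [TopologicalSpace H'] {J : ModelWithCorners ℝ E' H'}
  {G : Type*} [TopologicalSpace G] [ChartedSpace H' G] [Group G]

/-- The multiplication of `G` read in the chart at `1`. -/
noncomputable def chartMul (J : ModelWithCorners ℝ E' H') (G : Type*) [TopologicalSpace G]
    [ChartedSpace H' G] [Group G] (p : E' × E') : E' :=
  extChartAt J (1 : G) ((extChartAt J (1 : G)).symm p.1 * (extChartAt J (1 : G)).symm p.2)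

/-- The derivative of right translation at `1`, read in the chart at `1`. -/
noncomputable def chartRight (J : ModelWithCorners ℝ E' H') (G : Type*) [TopologicalSpace G]
    [ChartedSpace H' G] [Group G] (y : E') : E' →L[ℝ] E' :=
  fderiv ℝ (fun x ↦ chartMul J G (x, y)) (extChartAt J (1 : G) 1)

/-- The derivative of left translation at `1`, read in the chart at `1`. -/
noncomputable def chartLeft (J : ModelWithCorners ℝ E' H') (G : Type*) [TopologicalSpace G]
    [ChartedSpace H' G] [Group G] (y : E') : E' →L[ℝ] E' :=
  fderiv ℝ (fun x ↦ chartMul J G (y, x)) (extChartAt J (1 : G) 1)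

omit [Group G] in
theorem extChartAt_target_mem_nhds_of_boundaryless [BoundarylessManifold J G] (g : G) :
    (extChartAt J g).target ∈ 𝓝 (extChartAt J g g) :=
  mem_interior_iff_mem_nhds.1 (ModelWithCorners.isInteriorPoint_iff.1
    (BoundarylessManifold.isInteriorPoint (I := J) (x := g)))

variable [LieGroup J ∞ G]

theorem mdifferentiableAt_extChartAt_one {g : G} (hg : g ∈ (extChartAt J (1 : G)).source) :
    MDifferentiableAt J 𝓘(ℝ, E') (extChartAt J (1 : G)) g := by
  have : IsManifold J ∞ G := inferInstance
  exact (contMDiffAt_extChartAt' (n := ∞) (by simpa using hg)).mdifferentiableAt (by simp)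

variable [BoundarylessManifold J G]

theorem contMDiffAt_extChartAt_one_symm :
    ContMDiffAt 𝓘(ℝ, E') J ∞ (extChartAt J (1 : G)).symm (extChartAt J (1 : G) 1) :=
  (contMDiffOn_extChartAt_symm 1).contMDiffAt (extChartAt_target_mem_nhds_of_boundaryless 1)

theorem contDiffAt_chartMul :
    ContDiffAt ℝ ∞ (chartMul J G) (extChartAt J (1 : G) 1, extChartAt J (1 : G) 1) := by
  rw [← contMDiffAt_iff_contDiffAt]
  have h1 : ContMDiffAt 𝓘(ℝ, E' × E') J ∞
      (fun p : E' × E' ↦ (extChartAt J (1 : G)).symm p.1)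
      (extChartAt J (1 : G) 1, extChartAt J (1 : G) 1) :=
    ContMDiffAt.comp (g := (extChartAt J (1 : G)).symm) (I' := 𝓘(ℝ, E')) _
      contMDiffAt_extChartAt_one_symm contDiff_fst.contMDiff.contMDiffAt
  have h2 : ContMDiffAt 𝓘(ℝ, E' × E') J ∞
      (fun p : E' × E' ↦ (extChartAt J (1 : G)).symm p.2)
      (extChartAt J (1 : G) 1, extChartAt J (1 : G) 1) :=
    ContMDiffAt.comp (g := (extChartAt J (1 : G)).symm) (I' := 𝓘(ℝ, E')) _
      contMDiffAt_extChartAt_one_symm contDiff_snd.contMDiff.contMDiffAt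
  refine ContMDiffAt.comp (g := extChartAt J (1 : G)) (I' := J) _ ?_ (h1.mul h2)
  simpa using contMDiffAt_extChartAt (I := J) (n := ∞) (x := (1 : G))

theorem contDiffAt_chartRight : ContDiffAt ℝ ∞ (chartRight J G) (extChartAt J (1 : G) 1) :=
  contDiffAt_fderiv_left contDiffAt_chartMul

theorem contDiffAt_chartLeft : ContDiffAt ℝ ∞ (chartLeft J G) (extChartAt J (1 : G) 1) :=
  contDiffAt_fderiv_right contDiffAt_chartMul

omit [LieGroup J ∞ G] in
theorem chartRight_one :
    chartRight J G (extChartAt J (1 : G) 1) = ContinuousLinearMap.id ℝ E' := by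
  have : (fun x ↦ chartMul J G (x, extChartAt J (1 : G) 1)) =ᶠ[𝓝 (extChartAt J (1 : G) 1)] id := by
    filter_upwards [extChartAt_target_mem_nhds_of_boundaryless (J := J) (1 : G)] with x hx
    simp only [chartMul, extChartAt_to_inv, mul_one, id]
    exact (extChartAt J (1 : G)).right_inv hx
  rw [chartRight, this.fderiv_eq, fderiv_id]

omit [LieGroup J ∞ G] in
theorem chartLeft_one :
    chartLeft J G (extChartAt J (1 : G) 1) = ContinuousLinearMap.id ℝ E' := by
  have : (fun x ↦ chartMul J G (extChartAt J (1 : G) 1, x)) =ᶠ[𝓝 (extChartAt J (1 : G) 1)] id := by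
    filter_upwards [extChartAt_target_mem_nhds_of_boundaryless (J := J) (1 : G)] with x hx
    simp only [chartMul, extChartAt_to_inv, one_mul, id]
    exact (extChartAt J (1 : G)).right_inv hx
  rw [chartLeft, this.fderiv_eq, fderiv_id]

omit [LieGroup J ∞ G] in
theorem pushforward_one_eq_fderiv {f : G → E'} (hf : MDifferentiableAt J 𝓘(ℝ, E') f 1) :
    pushforward J 𝓘(ℝ, E') f 1 =
      fderiv ℝ (fun x ↦ f ((extChartAt J (1 : G)).symm x)) (extChartAt J (1 : G) 1) := by
  have hr : range J ∈ 𝓝 (extChartAt J (1 : G) 1) :=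
    mem_of_superset (extChartAt_target_mem_nhds_of_boundaryless 1) (extChartAt_target_subset_range 1)
  exact (show pushforward J 𝓘(ℝ, E') f 1 = fderivWithin ℝ _ (range J) _ from hf.mfderiv).trans
    (fderivWithin_of_mem_nhds hr)

theorem pushforward_chart_mul_right {g : G} (hg : g ∈ (extChartAt J (1 : G)).source) :
    pushforward J 𝓘(ℝ, E') (fun x ↦ extChartAt J (1 : G) (x * g)) 1 =
      chartRight J G (extChartAt J (1 : G) g) := by
  rw [pushforward_one_eq_fderiv, chartRight]
  · simp only [chartMul, (extChartAt J (1 : G)).left_inv hg]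
  · exact MDifferentiableAt.comp (g := extChartAt J (1 : G)) 1
      (mdifferentiableAt_extChartAt_one (by simpa using hg)) (mdifferentiableAt_mul_right_const g 1)

theorem pushforward_chart_mul_left {g : G} (hg : g ∈ (extChartAt J (1 : G)).source) :
    pushforward J 𝓘(ℝ, E') (fun x ↦ extChartAt J (1 : G) (g * x)) 1 =
      chartLeft J G (extChartAt J (1 : G) g) := by
  rw [pushforward_one_eq_fderiv, chartLeft]
  · simp only [chartMul, (extChartAt J (1 : G)).left_inv hg]
  · exact MDifferentiableAt.comp (g := extChartAt J (1 : G)) 1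
      (mdifferentiableAt_extChartAt_one (by simpa using hg)) (mdifferentiableAt_mul_left_const g 1)

/-- This turns the ratio into a solution of an ODE in a vector space. It serves both to compare
neighbouring slices and, with u₂ constant, to prove smoothness of a single solution. -/
theorem hasDerivAt_extChartAt_mul_inv {b₁ b₂ : ℝ → E'} {u₁ u₂ : ℝ → G} {t : ℝ}
    (h₁ : IsRightSolutionAt J b₁ u₁ t) (h₂ : IsRightSolutionAt J b₂ u₂ t)
    (hw : u₁ t * (u₂ t)⁻¹ ∈ (extChartAt J (1 : G)).source) :
    HasDerivAt (fun t ↦ extChartAt J (1 : G) (u₁ t * (u₂ t)⁻¹))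
      (-chartRight J G (extChartAt J (1 : G) (u₁ t * (u₂ t)⁻¹)) (b₁ t) +
        chartLeft J G (extChartAt J (1 : G) (u₁ t * (u₂ t)⁻¹)) (b₂ t)) t := by
  rw [← pushforward_chart_mul_right hw, ← pushforward_chart_mul_left hw]
  exact IsRightSolutionAt.hasDerivAt_mul_inv h₁ h₂ (mdifferentiableAt_extChartAt_one hw)

/-- The difference of the two sides is a commutator, which vanishes on parallel vectors; bilinearity
reduces this to the diagonal case. -/
theorem fderiv_chartRight_eq_fderiv_chartLeft (c d : ℝ) (x : E') :
    fderiv ℝ (chartRight J G) (extChartAt J (1 : G) 1) (c • x) (d • x) =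
      fderiv ℝ (chartLeft J G) (extChartAt J (1 : G) 1) (c • x) (d • x) := by
  have := fderiv_fderiv_left_eq_right (contDiffAt_chartMul (J := J) (G := G)) x
  simp only [map_smul, smul_apply]
  rw [show fderiv ℝ (chartRight J G) _ x x = _ from this]
  rfl

end GroupChart

/-! ### Fibres of the tangent bundle and time shifts. -/

section Fiber

variable {E : Type*} [NormedAddCommGroup E] [NormedSpace ℝ E]
  {H : Type*} [TopologicalSpace H] {I : ModelWithCorners ℝ E H}
  {M : Type*} [TopologicalSpace M] [ChartedSpace H M] [IsManifold I ∞ M]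

theorem contMDiff_tangentBundle_fiber (x : M) :
    ContMDiff 𝓘(ℝ, E) I.tangent ∞ (fun v : E ↦ (⟨x, v⟩ : TangentBundle I M)) := by
  intro v
  rw [Bundle.contMDiffAt_totalSpace]
  refine ⟨contMDiffAt_const, ?_⟩
  simp only [TangentBundle.trivializationAt_apply]
  exact (ContinuousLinearMap.contDiff _).contMDiff.contMDiffAt

omit [IsManifold I ∞ M] in
theorem HasVelocityAt.comp_const_add {u : ℝ → M} {v : E} {s t : ℝ}
    (hu : HasVelocityAt I u v (s + t)) : HasVelocityAt I (fun t ↦ u (s + t)) v t := by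
  have h1 : HasMFDerivAt 𝓘(ℝ, ℝ) 𝓘(ℝ, ℝ) (fun t ↦ s + t) t (ContinuousLinearMap.id ℝ ℝ) :=
    ((hasFDerivAt_id t).const_add s).hasMFDerivAt
  exact (HasMFDerivAt.comp t hu h1).congr_mfderiv rfl

end Fiber

/-! ### Existence, uniqueness and smoothness of solutions. -/

section RightODE

variable {E' : Type*} [NormedAddCommGroup E'] [NormedSpace ℝ E']
  {H' : Type*} [TopologicalSpace H'] {J : ModelWithCorners ℝ E' H'}
  {G : Type*} [TopologicalSpace G] [ChartedSpace H' G] [Group G]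

/-- The vector field `(1, -dr_g(b(t)))` on `ℝ × G`. -/
noncomputable def rightField (J : ModelWithCorners ℝ E' H') (b : ℝ → E') (x : ℝ × G) :
    TangentSpace (𝓘(ℝ, ℝ).prod J) x :=
  ((1 : ℝ), -pushforward J J (fun g : G ↦ g * x.2) 1 (b x.1))

theorem isMIntegralCurve_rightField {b : ℝ → E'} {u : ℝ → G}
    (hu : ∀ t, IsRightSolutionAt J b u t) :
    IsMIntegralCurve (I := 𝓘(ℝ, ℝ).prod J) (fun t ↦ (t, u t)) (rightField J b) :=
  fun t ↦ HasVelocityAt.prodMk (hasVelocityAt_iff_hasDerivAt.2 (hasDerivAt_id t)) (hu t)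

theorem hasVelocityAt_rightField_fst {b : ℝ → E'} {γ : ℝ → ℝ × G} {t : ℝ}
    (h : HasVelocityAt (𝓘(ℝ, ℝ).prod J) γ (rightField J b (γ t)) t) :
    HasDerivAt (fun t ↦ (γ t).1) 1 t := by
  rw [← hasVelocityAt_iff_hasDerivAt]
  have := h.comp (J := 𝓘(ℝ, ℝ)) mdifferentiableAt_fst
  convert! this using 1
  exact (congrArg (fun L : ℝ × E' →L[ℝ] ℝ ↦ L (rightField J b (γ t)))
    (mfderiv_fst (I := 𝓘(ℝ, ℝ)) (I' := J) (x := γ t))).symm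

theorem hasVelocityAt_rightField_snd {b : ℝ → E'} {γ : ℝ → ℝ × G} {t : ℝ}
    (h : HasVelocityAt (𝓘(ℝ, ℝ).prod J) γ (rightField J b (γ t)) t) :
    HasVelocityAt J (fun t ↦ (γ t).2)
      (-pushforward J J (fun g : G ↦ g * (γ t).2) 1 (b (γ t).1)) t := by
  have := h.comp (J := J) mdifferentiableAt_snd
  convert! this using 1
  exact (congrArg (fun L : ℝ × E' →L[ℝ] E' ↦ L (rightField J b (γ t)))
    (mfderiv_snd (I := 𝓘(ℝ, ℝ)) (I' := J) (x := γ t))).symm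

theorem isRightSolutionAt_const_of_eq_zero {b : ℝ → E'} {t : ℝ} (hb : b t = 0) (g : G) :
    IsRightSolutionAt J b (fun _ ↦ g) t := by
  unfold IsRightSolutionAt HasVelocityAt
  refine (hasMFDerivAt_const g t).congr_mfderiv ?_
  refine ContinuousLinearMap.ext_ring ?_
  rw [hb, map_zero, neg_zero, ContinuousLinearMap.smulRight_zero]
  rfl

variable [LieGroup J ∞ G]

/-- The map being differentiated varies with the base point, so smoothness is not immediate. The
group component is rewritten as the tangent map of multiplication applied to (-b(t), 0) over (1, g),
a composition of smooth maps. -/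
theorem contMDiff_rightField {b : ℝ → E'} (hb : ContDiff ℝ ∞ b) :
    ContMDiff (𝓘(ℝ, ℝ).prod J) (𝓘(ℝ, ℝ).prod J).tangent 1
      (fun x : ℝ × G ↦ (⟨x, rightField J b x⟩ : TangentBundle (𝓘(ℝ, ℝ).prod J) (ℝ × G))) := by
  have : IsManifold J ∞ G := inferInstance
  have : IsManifold J (1 + 1) G := IsManifold.of_le (n := ∞) (by norm_cast)
  have s1 : ContMDiff (𝓘(ℝ, ℝ).prod J) 𝓘(ℝ, ℝ).tangent 1
      (fun x : ℝ × G ↦ (⟨x.1, (1 : ℝ)⟩ : TangentBundle 𝓘(ℝ, ℝ) ℝ)) := by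
    have : ContMDiff 𝓘(ℝ, ℝ) 𝓘(ℝ, ℝ).tangent 1
        (fun x : ℝ ↦ (⟨x, (1 : ℝ)⟩ : TangentBundle 𝓘(ℝ, ℝ) ℝ)) :=
      contMDiff_vectorSpace_iff_contDiff.2 contDiff_const
    exact this.comp contMDiff_fst
  have t1 : ContMDiff (𝓘(ℝ, ℝ).prod J) J.tangent 1
      (fun x : ℝ × G ↦ (⟨1, -b x.1⟩ : TangentBundle J G)) :=
    ((contMDiff_tangentBundle_fiber (1 : G)).of_le (by simp)).comp
      ((hb.neg.of_le (by simp)).contMDiff.comp contMDiff_fst)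
  have t2 : ContMDiff (𝓘(ℝ, ℝ).prod J) J.tangent 1
      (fun x : ℝ × G ↦ (⟨x.2, (0 : E')⟩ : TangentBundle J G)) :=
    (Bundle.contMDiff_zeroSection ℝ (TangentSpace J (M := G))).comp contMDiff_snd
  have t3 := (contMDiff_equivTangentBundleProd_symm (n := 1) (I := J) (M := G) (I' := J)
    (M' := G)).comp (t1.prodMk t2)
  have t4 : ContMDiff (J.prod J).tangent J.tangent 1
      (tangentMap (J.prod J) J (fun p : G × G ↦ p.1 * p.2)) :=
    (contMDiff_mul J ∞).contMDiff_tangentMap (by norm_cast)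
  have key : ∀ x : ℝ × G, -pushforward J J (fun g : G ↦ g * x.2) 1 (b x.1) =
      pushforward (J.prod J) J (fun p : G × G ↦ p.1 * p.2) (1, x.2) (-b x.1, 0) := by
    intro x
    rw [pushforward_prod (mdifferentiableAt_group_mul _), map_neg, map_zero, add_zero]
  have s2 : ContMDiff (𝓘(ℝ, ℝ).prod J) J.tangent 1 (fun x : ℝ × G ↦
      (⟨x.2, -pushforward J J (fun g : G ↦ g * x.2) 1 (b x.1)⟩ : TangentBundle J G)) :=
    (t4.comp t3).congr fun x ↦ Bundle.TotalSpace.ext (one_mul x.2).symm (heq_of_eq (key x))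
  exact (contMDiff_equivTangentBundleProd_symm (n := 1) (I := 𝓘(ℝ, ℝ)) (M := ℝ) (I' := J)
    (M' := G)).comp (s1.prodMk s2)

theorem isRightSolution_unique [BoundarylessManifold J G] [T2Space G] [FiniteDimensional ℝ E']
    {b : ℝ → E'} (hb : ContDiff ℝ ∞ b) {u u' : ℝ → G} (hu : ∀ t, IsRightSolutionAt J b u t)
    (hu' : ∀ t, IsRightSolutionAt J b u' t) {t₀ : ℝ} (h : u t₀ = u' t₀) : u = u' := by
  have : IsManifold J ∞ G := inferInstance
  have : IsManifold J 1 G := IsManifold.of_le (n := ∞) (by simp)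
  have := FiniteDimensional.complete ℝ E'
  have key := isMIntegralCurve_Ioo_eq_of_contMDiff_boundaryless (t₀ := t₀)
    (contMDiff_rightField hb) (isMIntegralCurve_rightField hu) (isMIntegralCurve_rightField hu')
    (by simp [h])
  exact funext fun t ↦ congrArg Prod.snd (congrFun key t)

theorem exists_local_right_solution [BoundarylessManifold J G] [FiniteDimensional ℝ E']
    {b : ℝ → E'} (hb : ContDiff ℝ ∞ b) (t₀ : ℝ) :
    ∃ w : ℝ → G, ∀ᶠ t in 𝓝 t₀, IsRightSolutionAt J b w t := by
  have : IsManifold J ∞ G := inferInstance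
  have : IsManifold J 1 G := IsManifold.of_le (n := ∞) (by simp)
  have := FiniteDimensional.complete ℝ E'
  obtain ⟨γ, h0, hγ⟩ := exists_isMIntegralCurveAt_of_contMDiffAt_boundaryless (t₀ := t₀)
    (contMDiff_rightField (J := J) hb).contMDiffAt (x₀ := (t₀, (1 : G)))
  obtain ⟨ε, hε, hγ⟩ := Metric.eventually_nhds_iff_ball.1 hγ
  -- The time component of the integral curve has derivative 1 and the right initial value, so it is
  -- t itself and the autonomous system gives back the original equation.
  have hfst : ∀ t ∈ Metric.ball t₀ ε, (γ t).1 = t := by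
    have hd : ∀ t ∈ Metric.ball t₀ ε, HasDerivAt (fun t ↦ (γ t).1 - t) 0 t := by
      intro t ht
      have h := (hasVelocityAt_rightField_fst (hγ t ht)).sub (hasDerivAt_id t)
      rwa [sub_self] at h
    intro t ht
    have := Metric.isOpen_ball.is_const_of_deriv_eq_zero
      (convex_ball t₀ ε).isPreconnected (fun t ht ↦ (hd t ht).differentiableAt.differentiableWithinAt)
      (fun t ht ↦ (hd t ht).deriv) ht (Metric.mem_ball_self hε)
    simp only [h0, sub_self] at this
    exact sub_eq_zero.1 this
  refine ⟨fun t ↦ (γ t).2, Metric.eventually_nhds_iff_ball.2 ⟨ε, hε, fun t ht ↦ ?_⟩⟩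
  have := hasVelocityAt_rightField_snd (hγ t ht)
  rwa [hfst t ht] at this

theorem exists_uniform_right_solution [BoundarylessManifold J G] [FiniteDimensional ℝ E']
    {b : ℝ → E'} (hb : ContDiff ℝ ∞ b) (hb0 : ∀ t ∉ Icc (0 : ℝ) 1, b t = 0) :
    ∃ ε > 0, ∀ s : ℝ, ∃ w : ℝ → G, ∀ t ∈ Metric.ball s ε, IsRightSolutionAt J b w t := by
  choose w hw using exists_local_right_solution (J := J) (G := G) hb
  obtain ⟨δ, hδ, h⟩ := lebesgue_number_lemma_of_metric
    (c := fun s ↦ interior {t | IsRightSolutionAt J b (w s) t}) (isCompact_Icc (a := -1) (b := 2))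
    (fun _ ↦ isOpen_interior)
    (fun s _ ↦ mem_iUnion.2 ⟨s, mem_interior_iff_mem_nhds.2 (hw s)⟩)
  -- The Lebesgue number handles centres in [-1, 2]. A ball of radius at most 1 about any other
  -- centre misses [0, 1], where `b` may be nonzero, and constants are solutions there.
  refine ⟨min δ 1, by positivity, fun s ↦ ?_⟩
  by_cases hs : s ∈ Icc (-1 : ℝ) 2
  · obtain ⟨i, hi⟩ := h s hs
    have hi' : Metric.ball s δ ⊆ {t | IsRightSolutionAt J b (w i) t} := hi.trans interior_subset
    exact ⟨w i, fun t ht ↦ hi' (Metric.ball_subset_ball (min_le_left _ _) ht)⟩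
  · refine ⟨fun _ ↦ 1, fun t ht ↦ isRightSolutionAt_const_of_eq_zero (hb0 t ?_) 1⟩
    have h2 := (Metric.ball_subset_ball (min_le_right δ 1) ht)
    rw [Real.ball_eq_Ioo] at h2
    rintro ⟨h3, h4⟩
    exact hs ⟨by linarith [h2.2], by linarith [h2.1]⟩

theorem exists_right_solution [BoundarylessManifold J G] [T2Space G] [FiniteDimensional ℝ E']
    {b : ℝ → E'} (hb : ContDiff ℝ ∞ b) (hb0 : ∀ t ∉ Icc (0 : ℝ) 1, b t = 0) :
    ∃ u : ℝ → G, u 0 = 1 ∧ ∀ t, IsRightSolutionAt J b u t := by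
  have : IsManifold J ∞ G := inferInstance
  have : IsManifold J 1 G := IsManifold.of_le (n := ∞) (by simp)
  obtain ⟨ε, hε, h⟩ := exists_uniform_right_solution (J := J) (G := G) hb hb0
  have hglob := exists_isMIntegralCurve_of_isMIntegralCurveOn (contMDiff_rightField (J := J) hb) hε
    (fun x ↦ ?_) ((0 : ℝ), (1 : G))
  · obtain ⟨γ, h0, hγ⟩ := hglob
    have hd : ∀ t, HasDerivAt (fun t ↦ (γ t).1 - t) 0 t := fun t ↦ by
      have h := (hasVelocityAt_rightField_fst (hγ t)).sub (hasDerivAt_id t)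
      rwa [sub_self] at h
    have hfst : ∀ t, (γ t).1 = t := by
      intro t
      have := is_const_of_deriv_eq_zero (fun t ↦ (hd t).differentiableAt)
        (fun t ↦ (hd t).deriv) t 0
      simp only [h0, sub_self] at this
      exact sub_eq_zero.1 this
    refine ⟨fun t ↦ (γ t).2, by simp [h0], fun t ↦ ?_⟩
    have := hasVelocityAt_rightField_snd (hγ t)
    rwa [hfst t] at this
  · obtain ⟨s, g⟩ := x
    obtain ⟨w, hw⟩ := h s
    -- The local solution near s, right-translated to pass through g; the lifetime ε therefore does
    -- not depend on g.
    refine ⟨fun t ↦ (s + t, w (s + t) * ((w s)⁻¹ * g)), by simp, fun t ht ↦ ?_⟩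
    have h1 : s + t ∈ Metric.ball s ε := by
      simpa [Real.dist_eq, abs_lt] using ht
    have h2 := ((hw _ h1).mul_const ((w s)⁻¹ * g)).comp_const_add
    have h3 : HasVelocityAt 𝓘(ℝ, ℝ) (fun t ↦ s + t) (1 : ℝ) t :=
      hasVelocityAt_iff_hasDerivAt.2 ((hasDerivAt_id t).const_add s)
    exact (h3.prodMk h2).hasMFDerivWithinAt

/-- A solution of an ODE `y' = f(t, y)` with smooth `f` is smooth. -/
theorem contDiffAt_of_hasDerivAt_comp {F : Type*} [NormedAddCommGroup F] [NormedSpace ℝ F]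
    {f : ℝ × F → F} {y : ℝ → F} {t₀ : ℝ} (hf : ContDiffAt ℝ ∞ f (t₀, y t₀))
    (hy : ∀ᶠ t in 𝓝 t₀, HasDerivAt y (f (t, y t)) t) : ContDiffAt ℝ ∞ y t₀ := by
  rw [contDiffAt_infty]
  intro n
  have hc : ContinuousAt (fun t ↦ (t, y t)) t₀ :=
    continuousAt_id.prodMk hy.self_of_nhds.continuousAt
  -- Bootstrapping: if y is Cⁿ then y' = f(t, y) is Cⁿ, so y is Cⁿ⁺¹.
  induction n with
  | zero =>
    refine contDiffAt_zero.2 ⟨_, hy, fun t ht ↦ ?_⟩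
    exact (show HasDerivAt y (f (t, y t)) t from ht).continuousAt.continuousWithinAt
  | succ n ih =>
    have h1 : ContDiffAt ℝ n (fun t ↦ f (t, y t)) t₀ :=
      ContDiffAt.comp (g := f) t₀ (hf.of_le (by exact_mod_cast le_top)) (contDiffAt_id.prodMk ih)
    refine contDiffAt_succ_iff_hasFDerivAt.2
      ⟨fun t ↦ (1 : ℝ →L[ℝ] ℝ).smulRight (f (t, y t)), ⟨_, hy, fun t ht ↦ ?_⟩, ?_⟩
    · exact (show HasDerivAt y (f (t, y t)) t from ht).hasFDerivAt
    · exact contDiffAt_const.smulRight h1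

theorem contMDiff_right_solution [BoundarylessManifold J G]
    {b : ℝ → E'} (hb : ContDiff ℝ ∞ b) {u : ℝ → G} (hu : ∀ t, IsRightSolutionAt J b u t) :
    ContMDiff 𝓘(ℝ, ℝ) J ∞ u := by
  intro t₀
  have : IsManifold J ∞ G := inferInstance
  set e := extChartAt J (1 : G) 1 with he
  set w : ℝ → G := fun t ↦ u t * (u t₀)⁻¹ with hw
  have hw0 : w t₀ = 1 := by simp [hw]
  have hwc : Continuous w := by
    refine continuous_iff_continuousAt.2 fun t ↦ ?_
    exact HasVelocityAt.continuousAt ((hu t).mul_const _)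
  have hsrc : ∀ᶠ t in 𝓝 t₀, w t ∈ (extChartAt J (1 : G)).source := by
    refine hwc.continuousAt.eventually_mem ?_
    rw [hw0]
    exact extChartAt_source_mem_nhds 1
  have hy : ContDiffAt ℝ ∞ (fun t ↦ extChartAt J (1 : G) (w t)) t₀ := by
    refine contDiffAt_of_hasDerivAt_comp (f := fun p ↦ -chartRight J G p.2 (b p.1)) ?_ ?_
    · simp only [hw0]
      exact ((ContDiffAt.comp (g := chartRight J G) (t₀, e) contDiffAt_chartRight
        contDiffAt_snd).clm_apply (hb.comp contDiff_fst).contDiffAt).neg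
    · filter_upwards [hsrc] with t ht
      -- Comparison with a constant curve, a solution for the zero coefficient, removes the
      -- left-translation term.
      have h1 : IsRightSolutionAt J (fun _ ↦ 0) (fun _ ↦ u t₀) t :=
        isRightSolutionAt_const_of_eq_zero rfl _
      simpa using hasDerivAt_extChartAt_mul_inv (hu t) h1 ht
  have h2 : ContMDiffAt 𝓘(ℝ, ℝ) J ∞
      (fun t ↦ (extChartAt J (1 : G)).symm (extChartAt J (1 : G) (w t)) * u t₀) t₀ := by
    refine ContMDiffAt.mul ?_ contMDiffAt_const
    refine ContMDiffAt.comp (g := (extChartAt J (1 : G)).symm) (I' := 𝓘(ℝ, E')) t₀ ?_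
      hy.contMDiffAt
    rw [hw0]
    exact contMDiffAt_extChartAt_one_symm
  refine h2.congr_of_eventuallyEq ?_
  filter_upwards [hsrc] with t ht
  rw [(extChartAt J (1 : G)).left_inv ht]
  simp [hw]

end RightODE

/-! ### Grönwall's inequality inside a chart. -/

section Trap

variable {F : Type*} [NormedAddCommGroup F] [NormedSpace ℝ F]
  {M : Type*} [TopologicalSpace M]

/-- With zero initial error the bound is linear in the defect, so an o(σ) defect gives an o(σ)
error. -/
theorem gronwallBound_zero_mul (K c x : ℝ) :
    gronwallBound 0 K c x = c * gronwallBound 0 K 1 x := by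
  unfold gronwallBound
  split_ifs <;> ring

/-- Grönwall's inequality for a curve `w` in a space with a chart `φ`, where the differential
equation is only known while `w` stays in the preimage of the ball. -/
theorem dist_le_of_trapped [T2Space M] {φ : PartialEquiv M F} (hsrc : IsOpen φ.source)
    (hφ : ContinuousOn φ φ.source) (hφ' : ContinuousOn φ.symm φ.target) {e : F} {r : ℝ}
    (hball : Metric.closedBall e r ⊆ φ.target) (hcomp : IsCompact (Metric.closedBall e r))
    {w : ℝ → M} (hw : Continuous w) (hws : w 0 ∈ φ.source) (hw0 : φ (w 0) = e) (hr : 0 < r)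
    {Ψ : ℝ → F → F} {K : ℝ≥0}
    (hΨ : ∀ t ∈ Icc (0 : ℝ) 1, LipschitzOnWith K (Ψ t) (Metric.closedBall e r))
    (hode : ∀ t ∈ Icc (0 : ℝ) 1, w t ∈ φ.source → φ (w t) ∈ Metric.closedBall e r →
      HasDerivAt (fun t ↦ φ (w t)) (Ψ t (φ (w t))) t)
    {g g' : ℝ → F} (hg : ∀ t, HasDerivAt g (g' t) t) (hg0 : g 0 = e)
    (hgr : ∀ t ∈ Icc (0 : ℝ) 1, g t ∈ Metric.closedBall e (r / 2)) {η : ℝ} (hη : 0 ≤ η)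
    (hdef : ∀ t ∈ Icc (0 : ℝ) 1, ‖g' t - Ψ t (g t)‖ ≤ η) (hηr : gronwallBound 0 K η 1 < r / 2) :
    w 1 ∈ φ.source ∧ ‖φ (w 1) - g 1‖ ≤ gronwallBound 0 K η 1 := by
  -- `V` is compact in a Hausdorff space, hence closed in `M`, so `w` cannot leave the chart domain
  -- by a limit.
  set V : Set M := φ.symm '' Metric.closedBall e r with hV
  have hVc : IsClosed V := (hcomp.image_of_continuousOn (hφ'.mono hball)).isClosed
  have hVs : ∀ x, x ∈ V ↔ x ∈ φ.source ∧ φ x ∈ Metric.closedBall e r := by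
    intro x
    constructor
    · rintro ⟨y, hy, rfl⟩
      exact ⟨φ.map_target (hball hy), by rwa [φ.right_inv (hball hy)]⟩
    · rintro ⟨h1, h2⟩
      exact ⟨φ x, h2, φ.left_inv h1⟩
  have hstep : ∀ T ∈ Icc (0 : ℝ) 1, (∀ t ∈ Icc 0 T, w t ∈ V) →
      w T ∈ φ.source ∧ ‖φ (w T) - g T‖ ≤ gronwallBound 0 K η 1 := by
    intro T hT hwV
    refine ⟨((hVs _).1 (hwV T ⟨hT.1, le_rfl⟩)).1, ?_⟩
    have hsub : ∀ t ∈ Icc 0 T, t ∈ Icc (0 : ℝ) 1 := fun t ht ↦ ⟨ht.1, ht.2.trans hT.2⟩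
    have hd : ∀ t ∈ Icc 0 T, HasDerivAt (fun t ↦ φ (w t)) (Ψ t (φ (w t))) t := fun t ht ↦
      hode t (hsub t ht) ((hVs _).1 (hwV t ht)).1 ((hVs _).1 (hwV t ht)).2
    have hb := norm_le_gronwallBound_of_norm_deriv_right_le (f := fun t ↦ φ (w t) - g t)
      (f' := fun t ↦ Ψ t (φ (w t)) - g' t) (δ := 0) (K := K) (ε := η) (a := 0) (b := T)
      (fun t ht ↦ ((hd t ht).sub (hg t)).continuousAt.continuousWithinAt)
      (fun t ht ↦ ((hd t (Ico_subset_Icc_self ht)).sub (hg t)).hasDerivWithinAt)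
      (by simp [hw0, hg0]) (fun t ht ↦ ?_) T ⟨hT.1, le_rfl⟩
    · rw [sub_zero] at hb
      exact hb.trans (gronwallBound_mono le_rfl hη K.2 hT.2)
    · have ht := Ico_subset_Icc_self ht
      have h1 := (hΨ t (hsub t ht)).norm_sub_le ((hVs _).1 (hwV t ht)).2
        (Metric.closedBall_subset_closedBall (by linarith) (hgr t (hsub t ht)))
      have h2 := hdef t (hsub t ht)
      calc ‖Ψ t (φ (w t)) - g' t‖
          = ‖(Ψ t (φ (w t)) - Ψ t (g t)) - (g' t - Ψ t (g t))‖ := by congr 1; abel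
        _ ≤ _ := (norm_sub_le _ _).trans (add_le_add h1 h2)
  -- The approximate solution stays within r/2 of e and the error is below r/2, so `w T` lies over
  -- the open ball and trapping persists past T.
  have hnhds : ∀ T ∈ Icc (0 : ℝ) 1, (∀ t ∈ Icc 0 T, w t ∈ V) → ∀ᶠ t in 𝓝 T, w t ∈ V := by
    intro T hT hwV
    obtain ⟨h1, h2⟩ := hstep T hT hwV
    have h3 : φ (w T) ∈ Metric.ball e r := by
      have := hgr T hT
      rw [mem_closedBall_iff_norm] at this
      rw [mem_ball_iff_norm]
      calc ‖φ (w T) - e‖ = ‖(φ (w T) - g T) + (g T - e)‖ := by congr 1; abel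
        _ ≤ _ := norm_add_le _ _
        _ < r := by linarith
    have h4 := (hφ.isOpen_inter_preimage hsrc Metric.isOpen_ball).mem_nhds ⟨h1, h3⟩
    filter_upwards [hw.continuousAt.preimage_mem_nhds h4] with t ht
    exact (hVs _).2 ⟨ht.1, Metric.ball_subset_closedBall ht.2⟩
  -- Within [0, 1], T ∈ S says that `w` is in `V` on the half-open interval [0, T). In this form `S`
  -- is closed at once; `hSV` recovers the endpoint, and continuous induction reaches 1.
  set S : Set ℝ := {T | ∀ t ∈ Icc (0 : ℝ) 1, w t ∈ V ∨ T ≤ t} with hS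
  have hSc : IsClosed S := by
    have : S = ⋂ t ∈ Icc (0 : ℝ) 1, {T | w t ∈ V ∨ T ≤ t} := by
      ext T; simp [hS]
    rw [this]
    refine isClosed_biInter fun t _ ↦ ?_
    by_cases h : w t ∈ V
    · simp [h]
    · simp only [h, false_or]
      exact isClosed_Iic
  have hwV0 : w 0 ∈ V := (hVs _).2 ⟨hws, by rw [hw0]; exact Metric.mem_closedBall_self hr.le⟩
  have hSV : ∀ T ∈ Icc (0 : ℝ) 1, T ∈ S → ∀ t ∈ Icc 0 T, w t ∈ V := by
    intro T hT hTS
    have hlt : ∀ t ∈ Ico 0 T, w t ∈ V := fun t ht ↦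
      (hTS t ⟨ht.1, ht.2.le.trans hT.2⟩).resolve_right (not_le.2 ht.2)
    intro t ht
    rcases ht.2.lt_or_eq with h | h
    · exact hlt t ⟨ht.1, h⟩
    rcases ht.1.eq_or_lt with h0 | h0
    · rwa [← h0]
    have : t ∈ closure (Ico 0 T) := by
      rw [closure_Ico (by linarith)]; exact ht
    exact (hVc.preimage hw).closure_subset_iff.2 (fun t ht ↦ hlt t ht) this
  have h1S : (1 : ℝ) ∈ S := by
    refine (hSc.inter isClosed_Icc).Icc_subset_of_forall_mem_nhdsWithin (a := 0) (b := 1)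
      (fun t ht ↦ Or.inr ht.1) (fun T hT ↦ ?_) ⟨zero_le_one, le_rfl⟩
    have hT' := Ico_subset_Icc_self hT.2
    have hT1 := hSV T hT' hT.1
    obtain ⟨δ, hδ, hb⟩ := Metric.eventually_nhds_iff_ball.1 (hnhds T hT' hT1)
    filter_upwards [Ioo_mem_nhdsGT (show T < T + δ by linarith)] with T' hT1' t ht
    by_cases h : t ≤ T
    · exact Or.inl (hT1 t ⟨ht.1, h⟩)
    by_cases h' : T' ≤ t
    · exact Or.inr h'
    · refine Or.inl (hb t ?_)
      rw [Real.ball_eq_Ioo]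
      exact ⟨by linarith, by linarith [hT1'.2]⟩
  exact hstep 1 ⟨zero_le_one, le_rfl⟩ (hSV 1 ⟨zero_le_one, le_rfl⟩ h1S)

end Trap

/-! ### Flatness makes the endpoint independent of the parameter. -/

section Flat

variable {E' : Type*} [NormedAddCommGroup E'] [NormedSpace ℝ E'] [FiniteDimensional ℝ E']
  {H' : Type*} [TopologicalSpace H'] {J : ModelWithCorners ℝ E' H'}
  {G : Type*} [TopologicalSpace G] [ChartedSpace H' G] [Group G] [LieGroup J ∞ G]
  [BoundarylessManifold J G] [T2Space G]

-- The curve and the constant curve are both integral curves of the zero vector field, so uniqueness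
-- identifies them.
omit [FiniteDimensional ℝ E'] in
theorem eq_of_hasVelocityAt_zero {c : ℝ → G} (hc : ∀ s, HasVelocityAt J c 0 s) (s s' : ℝ)
    [CompleteSpace E'] : c s = c s' := by
  have : IsManifold J ∞ G := inferInstance
  have : IsManifold J (1 + 1) G := IsManifold.of_le (n := ∞) (by norm_cast)
  have : IsManifold J 1 G := IsManifold.of_le (n := ∞) (by simp)
  have h0 : ContMDiff J J.tangent 1 (fun x : G ↦ (⟨x, (0 : E')⟩ : TangentBundle J G)) :=
    Bundle.contMDiff_zeroSection ℝ (TangentSpace J (M := G))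
  have h1 : IsMIntegralCurve (I := J) c (fun _ ↦ (0 : E')) := hc
  have h2 : IsMIntegralCurve (I := J) (fun _ ↦ c s') (fun _ : G ↦ (0 : E')) := fun t ↦ by
    refine (hasMFDerivAt_const (c s') t).congr_mfderiv ?_
    exact (ContinuousLinearMap.smulRight_zero (M₂ := E') (1 : ℝ →L[ℝ] ℝ)).symm
  exact congrFun (isMIntegralCurve_Ioo_eq_of_contMDiff_boundaryless (t₀ := s') h0 h1 h2 rfl) s

theorem hasDerivAt_right_solution_of_flat {a B : ℝ × ℝ → E'} (ha : ContDiff ℝ ∞ a)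
    (hB : ContDiff ℝ ∞ B) (hflat : ∀ p, fderiv ℝ a p (0, 1) = fderiv ℝ B p (1, 0))
    (hpar : ∀ p, ∃ (c d : ℝ) (x : E'), a p = c • x ∧ B p = d • x)
    (ha0 : ∀ s, a (s, 0) = 0) (ha1 : ∀ s, a (s, 1) = 0) {u : ℝ → ℝ → G} (hu0 : ∀ s, u s 0 = 1)
    (hu : ∀ s t, IsRightSolutionAt J (fun t ↦ B (s, t)) (u s) t) (s₀ : ℝ) :
    (∀ᶠ s in 𝓝 s₀, u s 1 * (u s₀ 1)⁻¹ ∈ (extChartAt J (1 : G)).source) ∧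
    HasDerivAt (fun s ↦ extChartAt J (1 : G) (u s 1 * (u s₀ 1)⁻¹)) 0 s₀ := by
  have : ProperSpace E' := FiniteDimensional.proper_real E'
  set e := extChartAt J (1 : G) 1 with he
  obtain ⟨KR, UR, hUR, hLR⟩ := ((contDiffAt_chartRight (J := J) (G := G)).of_le
    (show (1 : WithTop ℕ∞) ≤ ∞ by simp)).exists_lipschitzOnWith
  obtain ⟨KN, UN, hUN, hLN⟩ := ((contDiffAt_chartLeft (J := J) (G := G)).of_le
    (show (1 : WithTop ℕ∞) ≤ ∞ by simp)).exists_lipschitzOnWith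
  obtain ⟨r, hr, hball⟩ := Metric.nhds_basis_closedBall.mem_iff.1
    (inter_mem (extChartAt_target_mem_nhds_of_boundaryless (J := J) (1 : G)) (inter_mem hUR hUN))
  obtain ⟨MB, hMB⟩ := ((isCompact_Icc (a := s₀ - 1) (b := s₀ + 1)).prod
    (isCompact_Icc (a := (0 : ℝ)) (b := 1))).exists_bound_of_continuousOn hB.continuous.continuousOn
  obtain ⟨Ma, hMa⟩ := (isCompact_Icc (a := (0 : ℝ)) (b := 1)).exists_bound_of_continuousOn
    (ha.continuous.comp (Continuous.prodMk_right s₀)).continuousOn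
  have hMB0 : 0 ≤ MB := (norm_nonneg _).trans (hMB (s₀, 0) (by simp))
  -- A Lipschitz constant for the ratio equation valid for all |σ| ≤ 1, so that the Grönwall factor
  -- `C` does not depend on σ.
  set K : ℝ≥0 := (KR + KN) * ⟨MB, hMB0⟩ with hK
  set C := gronwallBound 0 K 1 1 with hC
  have hC0 : 0 ≤ C := by
    have := gronwallBound_mono le_rfl zero_le_one K.2 (show (0 : ℝ) ≤ 1 by norm_num)
    rwa [gronwallBound_x0] at this
  set Ψ : ℝ → ℝ → E' → E' := fun σ t y ↦
    -chartRight J G y (B (s₀ + σ, t)) + chartLeft J G y (B (s₀, t)) with hΨ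
  have hLip : ∀ σ, |σ| ≤ 1 → ∀ t ∈ Icc (0 : ℝ) 1,
      LipschitzOnWith K (Ψ σ t) (Metric.closedBall e r) := by
    intro σ hσ t ht
    refine LipschitzOnWith.of_dist_le_mul fun y hy y' hy' ↦ ?_
    have h1 := hLR.norm_sub_le (hball hy).2.1 (hball hy').2.1
    have h2 := hLN.norm_sub_le (hball hy).2.2 (hball hy').2.2
    have b1 : ‖B (s₀ + σ, t)‖ ≤ MB := hMB _ ⟨⟨by linarith [neg_le_of_abs_le hσ],
      by linarith [le_of_abs_le hσ]⟩, ht⟩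
    have b2 : ‖B (s₀, t)‖ ≤ MB := hMB _ ⟨⟨by linarith, by linarith⟩, ht⟩
    have c1 := (chartRight J G y - chartRight J G y').le_of_opNorm_le_of_le h1 b1
    have c2 := (chartLeft J G y - chartLeft J G y').le_of_opNorm_le_of_le h2 b2
    rw [dist_eq_norm, dist_eq_norm]
    calc ‖Ψ σ t y - Ψ σ t y'‖ = ‖(chartLeft J G y - chartLeft J G y') (B (s₀, t)) -
          (chartRight J G y - chartRight J G y') (B (s₀ + σ, t))‖ := by
            congr 1; simp only [hΨ, sub_apply]; abel
      _ ≤ _ := (norm_sub_le _ _).trans (add_le_add c2 c1)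
      _ = K * ‖y - y'‖ := by rw [show (K : ℝ) = (KR + KN) * MB from rfl]; ring
  have hcont : ∀ s, Continuous (u s) := fun s ↦
    continuous_iff_continuousAt.2 fun t ↦ HasVelocityAt.continuousAt (hu s t)
  have key : ∀ ε > 0, ∀ᶠ σ in 𝓝 (0 : ℝ),
      u (s₀ + σ) 1 * (u s₀ 1)⁻¹ ∈ (extChartAt J (1 : G)).source ∧
      ‖extChartAt J (1 : G) (u (s₀ + σ) 1 * (u s₀ 1)⁻¹) - e‖ ≤ ε * |σ| := by
    intro ε hε
    -- The defect is amplified by at most `C`, and C · ε/(C + 1) ≤ ε; the added 1 keeps the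
    -- denominator positive.
    have hε' : 0 < ε / (C + 1) := by positivity
    have E1 := eventually_norm_defect_le (contDiffAt_chartRight (J := J) (G := G))
      contDiffAt_chartLeft chartRight_one chartLeft_one ha hB (s₀ := s₀)
      (isCompact_Icc (a := (0 : ℝ)) (b := 1)) (fun t _ ↦ hflat _) (fun t _ ↦ by
        obtain ⟨c, d, x, h1, h2⟩ := hpar (s₀, t)
        rw [h1, h2, fderiv_chartRight_eq_fderiv_chartLeft]) hε'
    have E2 : ∀ᶠ σ in 𝓝 (0 : ℝ), |σ| < 1 :=
      (continuous_abs.tendsto' 0 0 (by simp)).eventually_lt_const one_pos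
    have E3 : ∀ᶠ σ in 𝓝 (0 : ℝ), |σ| * Ma < r / 2 :=
      ((continuous_abs.mul continuous_const).tendsto' 0 0 (by simp)).eventually_lt_const
        (half_pos hr)
    have E4 : ∀ᶠ σ in 𝓝 (0 : ℝ), ε / (C + 1) * |σ| * C < r / 2 :=
      (((continuous_const.mul continuous_abs).mul continuous_const).tendsto' 0 0
        (by simp)).eventually_lt_const (half_pos hr)
    filter_upwards [E1, E2, E3, E4] with σ h1 h2 h3 h4
    have hg : ∀ t, HasDerivAt (fun t ↦ e - σ • a (s₀, t)) (-(σ • fderiv ℝ a (s₀, t) (0, 1))) t := by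
      intro t
      have h5 : HasDerivAt (fun t : ℝ ↦ (s₀, t)) ((0 : ℝ), (1 : ℝ)) t :=
        (hasDerivAt_const _ _).prodMk (hasDerivAt_id _)
      have h6 := ((ha.differentiable (by simp) (s₀, t)).hasFDerivAt.comp_hasDerivAt t h5)
      exact (h6.const_smul σ).const_sub e
    have h5 := dist_le_of_trapped (φ := extChartAt J (1 : G)) (isOpen_extChartAt_source 1)
      (continuousOn_extChartAt 1) (continuousOn_extChartAt_symm 1)
      (hball.trans inter_subset_left) (isCompact_closedBall e r)
      (w := fun t ↦ u (s₀ + σ) t * (u s₀ t)⁻¹) ?_ (by simp [hu0])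
      (by simp only [hu0, inv_one, mul_one]) hr
      (hLip σ h2.le) (fun t ht hs _ ↦ hasDerivAt_extChartAt_mul_inv (hu _ t) (hu _ t) hs)
      hg (by simp [ha0, he]) ?_ (η := ε / (C + 1) * |σ|) (by positivity) h1
      (by rw [gronwallBound_zero_mul]; exact h4)
    · refine ⟨h5.1, ?_⟩
      have h6 := h5.2
      -- As a(s₀, 1) = 0, the approximate solution ends exactly at e.
      simp only [ha1, smul_zero, sub_zero] at h6
      refine h6.trans ?_
      rw [gronwallBound_zero_mul, ← hC, div_mul_eq_mul_div, div_mul_eq_mul_div,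
        div_le_iff₀ (by positivity)]
      have : 0 ≤ ε * |σ| := by positivity
      linarith
    · have := contMDiff_inv J ∞ (G := G)
      exact (contMDiff_mul J ∞).continuous.comp
        ((hcont _).prodMk (this.continuous.comp (hcont _)))
    · intro t ht
      rw [mem_closedBall_iff_norm]
      have := hMa t ht
      calc ‖e - σ • a (s₀, t) - e‖ = |σ| * ‖a (s₀, t)‖ := by simp [norm_smul]
        _ ≤ |σ| * Ma := by gcongr; exact this
        _ ≤ r / 2 := h3.le
  constructor
  · have h1 : Tendsto (fun s ↦ s - s₀) (𝓝 s₀) (𝓝 0) :=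
      (continuous_id.sub continuous_const).tendsto' _ _ (by simp)
    filter_upwards [h1.eventually (key 1 one_pos)] with s hs
    simpa using hs.1
  · rw [hasDerivAt_iff_isLittleO_nhds_zero]
    refine Asymptotics.IsLittleO.of_bound fun ε hε ↦ ?_
    filter_upwards [key ε hε] with σ hσ
    simpa [he] using hσ.2

theorem right_solution_eq_of_flat {a B : ℝ × ℝ → E'} (ha : ContDiff ℝ ∞ a)
    (hB : ContDiff ℝ ∞ B) (hflat : ∀ p, fderiv ℝ a p (0, 1) = fderiv ℝ B p (1, 0))
    (hpar : ∀ p, ∃ (c d : ℝ) (x : E'), a p = c • x ∧ B p = d • x)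
    (ha0 : ∀ s, a (s, 0) = 0) (ha1 : ∀ s, a (s, 1) = 0) {u : ℝ → ℝ → G} (hu0 : ∀ s, u s 0 = 1)
    (hu : ∀ s t, IsRightSolutionAt J (fun t ↦ B (s, t)) (u s) t) (s s' : ℝ) :
    u s 1 = u s' 1 := by
  have := FiniteDimensional.complete ℝ E'
  refine eq_of_hasVelocityAt_zero (J := J) (c := fun s ↦ u s 1) (fun s₀ ↦ ?_) s s'
  obtain ⟨h1, h2⟩ := hasDerivAt_right_solution_of_flat ha hB hflat hpar ha0 ha1 hu0 hu s₀
  -- Near s₀, u_s(1) is recovered from the chart value of the ratio by this differentiable map,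
  -- which sends the zero derivative to zero velocity.
  have h3 : MDifferentiableAt 𝓘(ℝ, E') J
      (fun y ↦ (extChartAt J (1 : G)).symm y * u s₀ 1)
      (extChartAt J (1 : G) (u s₀ 1 * (u s₀ 1)⁻¹)) := by
    refine MDifferentiableAt.comp (g := fun g : G ↦ g * u s₀ 1) _
      (mdifferentiableAt_mul_right_const _ _) ?_
    rw [mul_inv_cancel]
    exact contMDiffAt_extChartAt_one_symm.mdifferentiableAt (by simp)
  have h4 := (hasVelocityAt_iff_hasDerivAt.2 h2).comp h3
  rw [map_zero] at h4
  refine h4.congr_of_eventuallyEq ?_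
  filter_upwards [h1] with s hs
  rw [(extChartAt J (1 : G)).left_inv hs]
  simp

end Flat

/-! ### Closedness of a pulled-back form in rank one, in coordinates. -/

section Fiber

variable {E : Type*} [NormedAddCommGroup E] [NormedSpace ℝ E]
  {E' : Type*} [NormedAddCommGroup E'] [NormedSpace ℝ E']

theorem contMDiff_tangentBundle_mk :
    ContMDiff 𝓘(ℝ, E × E) 𝓘(ℝ, E).tangent ∞
      (fun p : E × E ↦ (⟨p.1, p.2⟩ : TangentBundle 𝓘(ℝ, E) E)) := by
  intro p
  rw [Bundle.contMDiffAt_totalSpace]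
  refine ⟨contDiff_fst.contMDiff.contMDiffAt, ?_⟩
  simp only [TangentBundle.trivializationAt_apply]
  convert! (contDiff_snd (𝕜 := ℝ) (E := E) (F := E) (n := ∞)).contMDiff.contMDiffAt using 1
  ext q
  simp only [fderivWithin_univ, modelWithCornersSelf_coe, range_id, mfld_simps]
  exact congrArg (fun L : E →L[ℝ] E ↦ L q.2) fderiv_id

/-- If `α` is linear in its second variable, the derivative of `q ↦ α(f q, Df_q v)` in the direction
`w` is symmetric in `v`, `w` when `Df v` and `Df w` are parallel. -/
theorem fderiv_form_symm {W : Type*} [NormedAddCommGroup W] [NormedSpace ℝ W]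
    {α : E → E →L[ℝ] E'} {f : W → E} {p v w : W} (hf : ContDiffAt ℝ ∞ f p)
    (hα : ∀ x, ContDiffAt ℝ ∞ (fun z : E × E ↦ α z.1 z.2) (f p, x)) {c d : ℝ} {x : E}
    (hv : fderiv ℝ f p v = c • x) (hw : fderiv ℝ f p w = d • x) :
    fderiv ℝ (fun q ↦ α (f q) (fderiv ℝ f q v)) p w =
      fderiv ℝ (fun q ↦ α (f q) (fderiv ℝ f q w)) p v := by
  have hf1 := (hf.differentiableAt (by simp)).hasFDerivAt
  have hf2 : HasFDerivAt (fderiv ℝ f) _ p :=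
    ((hf.fderiv_right (m := 1) (by norm_cast)).differentiableAt (by simp)).hasFDerivAt
  have hαd : ∀ y, HasFDerivAt (fun z : E × E ↦ α z.1 z.2) _ (f p, y) := fun y ↦
    ((hα y).differentiableAt (by simp)).hasFDerivAt
  have hchain : ∀ v, HasFDerivAt (fun q ↦ α (f q) (fderiv ℝ f q v)) _ p := fun v ↦
    HasFDerivAt.comp (f := fun q ↦ (f q, fderiv ℝ f q v)) p (hαd _)
      (hf1.prodMk (hf2.clm_apply (hasFDerivAt_const v p)))
  have hleft : ∀ y W, fderiv ℝ (fun z : E × E ↦ α z.1 z.2) (f p, y) (W, 0) =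
      fderiv ℝ (fun z ↦ α z y) (f p) W := fun y W ↦ by
    have := (hαd y).comp (f p) (hasFDerivAt_prodMk_left (𝕜 := ℝ) (f p) y)
    have h2 : HasFDerivAt (fun z ↦ α z y) _ (f p) := this
    rw [h2.fderiv]
    simp
  have hright : ∀ y U, fderiv ℝ (fun z : E × E ↦ α z.1 z.2) (f p, y) (0, U) = α (f p) U :=
      fun y U ↦ by
    have h2 : HasFDerivAt (fun z ↦ α (f p) z) _ y :=
      (hαd y).comp y (hasFDerivAt_prodMk_right (𝕜 := ℝ) (f p) y)
    have h3 := h2.unique (α (f p)).hasFDerivAt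
    rw [← h3]
    simp
  have hsmul : ∀ (c : ℝ) (y W : E), fderiv ℝ (fun z ↦ α z (c • y)) (f p) W =
      c • fderiv ℝ (fun z ↦ α z y) (f p) W := fun c y W ↦ by
    have h2 : DifferentiableAt ℝ (fun z ↦ α z y) (f p) :=
      (HasFDerivAt.comp (f := fun z ↦ (z, y)) (f p) (hαd y)
        (hasFDerivAt_prodMk_left (𝕜 := ℝ) (f p) y)).differentiableAt
    simp only [map_smul]
    rw [fderiv_fun_const_smul h2]
    rfl
  have hsplit : ∀ y W U, fderiv ℝ (fun z : E × E ↦ α z.1 z.2) (f p, y) (W, U) =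
      fderiv ℝ (fun z ↦ α z y) (f p) W + α (f p) U := fun y W U ↦ by
    rw [← hleft, ← hright y, ← map_add]
    simp
  have hs : fderiv ℝ (fderiv ℝ f) p w v = fderiv ℝ (fderiv ℝ f) p v w :=
    (hf.isSymmSndFDerivAt (by simp; norm_cast)) w v
  rw [(hchain v).fderiv, (hchain w).fderiv]
  simp only [ContinuousLinearMap.comp_apply, ContinuousLinearMap.prod_apply, hsplit, hv, hw]
  -- The second-order terms agree by `hs`. The terms differentiating α in its base point both equal
  -- cd times its derivative along x, evaluated on x.
  rw [hsmul, hsmul]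
  simp [hs, smul_comm c d]

end Fiber

/-! ### Components of pulled-back one-forms. -/

section OneForm

variable {E : Type*} [NormedAddCommGroup E] [NormedSpace ℝ E]
  {H : Type*} [TopologicalSpace H] {I : ModelWithCorners ℝ E H}
  {X : Type*} [TopologicalSpace X] [ChartedSpace H X] [IsManifold I ∞ X]
  {E' : Type*} [NormedAddCommGroup E'] [NormedSpace ℝ E']
  {H' : Type*} [TopologicalSpace H'] {J : ModelWithCorners ℝ E' H'}
  {G : Type*} [TopologicalSpace G] [ChartedSpace H' G] [Group G]
  {W : Type*} [NormedAddCommGroup W] [NormedSpace ℝ W]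

/-- The value of a 1-form at a point, as a linear map between the model spaces. -/
def LieOneForm.eval (A : LieOneForm I X J G) (x : X) : E →L[ℝ] E' :=
  A.toFun x

/-- The component of the pullback `f^*A` in the constant direction `v`. -/
noncomputable def LieOneForm.component (A : LieOneForm I X J G) (f : W → X) (v : W) (p : W) : E' :=
  A.eval (f p) (pushforward 𝓘(ℝ, W) I f p v)

theorem LieOneForm.contDiff_component (A : LieOneForm I X J G) {f : W → X}
    (hf : ContMDiff 𝓘(ℝ, W) I ∞ f) (v : W) : ContDiff ℝ ∞ (A.component f v) := by
  rw [← contMDiff_iff_contDiff]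
  have h1 : ContMDiff 𝓘(ℝ, W) 𝓘(ℝ, W).tangent ∞
      (fun p ↦ (⟨p, v⟩ : TangentBundle 𝓘(ℝ, W) W)) :=
    contMDiff_vectorSpace_iff_contDiff.2 contDiff_const
  exact A.smooth.comp ((hf.contMDiff_tangentMap (m := ∞) (by simp)).comp h1)

/-- This is d(f^*A)(v, w) = (dA)(f_*v, f_*w) = 0 for parallel f_*v, f_*w. No exterior derivative on
X is formed: near `f p` the form is written in a chart as α, and `fderiv_form_symm` applies. -/
theorem LieOneForm.fderiv_component_symm [BoundarylessManifold I X] (A : LieOneForm I X J G)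
    {f : W → X} (hf : ContMDiff 𝓘(ℝ, W) I ∞ f) {p v w : W} {c d : ℝ} {x : E}
    (hv : pushforward 𝓘(ℝ, W) I f p v = c • x) (hw : pushforward 𝓘(ℝ, W) I f p w = d • x) :
    fderiv ℝ (A.component f v) p w = fderiv ℝ (A.component f w) p v := by
  set ψ := extChartAt I (f p) with hψ
  -- The absence of boundary makes the chart image a neighbourhood of the point; its interior is an
  -- open set on which ordinary derivatives can be used.
  have hint : interior ψ.target ∈ 𝓝 (ψ (f p)) :=
    interior_mem_nhds.2 (extChartAt_target_mem_nhds_of_boundaryless (J := I) (f p))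
  have hψs : ContMDiffOn 𝓘(ℝ, E) I ∞ ψ.symm (interior ψ.target) :=
    (contMDiffOn_extChartAt_symm (f p)).mono interior_subset
  have hψf : ContMDiffAt 𝓘(ℝ, W) 𝓘(ℝ, E) ∞ (fun q ↦ ψ (f q)) p :=
    ContMDiffAt.comp (g := ψ) p contMDiffAt_extChartAt hf.contMDiffAt
  have hψfp : ContDiffAt ℝ ∞ (fun q ↦ ψ (f q)) p := hψf.contDiffAt
  set α : E → E →L[ℝ] E' := fun z ↦
    (A.eval (ψ.symm z)).comp (pushforward 𝓘(ℝ, E) I ψ.symm z) with hα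
  have hαs : ∀ y, ContDiffAt ℝ ∞ (fun z : E × E ↦ α z.1 z.2) (ψ (f p), y) := by
    intro y
    rw [← contMDiffAt_iff_contDiffAt]
    have h1 := hψs.contMDiffOn_tangentMapWithin (m := ∞) (by simp)
      (isOpen_interior.uniqueMDiffOn)
    have h2 : ContMDiffOn 𝓘(ℝ, E).tangent I.tangent ∞ (tangentMap 𝓘(ℝ, E) I ψ.symm)
        (Bundle.TotalSpace.proj ⁻¹' interior ψ.target) := by
      refine h1.congr fun z hz ↦ ?_
      rw [tangentMapWithin_eq_tangentMap]
      · exact isOpen_interior.uniqueMDiffWithinAt hz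
      · exact (hψs.contMDiffAt (isOpen_interior.mem_nhds hz)).mdifferentiableAt (by simp)
    have h3 : ContMDiffAt 𝓘(ℝ, E).tangent I.tangent ∞ (tangentMap 𝓘(ℝ, E) I ψ.symm)
        (⟨ψ (f p), y⟩ : TangentBundle 𝓘(ℝ, E) E) :=
      h2.contMDiffAt ((isOpen_interior.preimage (FiberBundle.continuous_proj E _)).mem_nhds
        (show ψ (f p) ∈ interior ψ.target from mem_of_mem_nhds hint))
    exact A.smooth.contMDiffAt.comp _ (h3.comp (ψ (f p), y) contMDiff_tangentBundle_mk.contMDiffAt)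
  have hcomp : ∀ v, A.component f v =ᶠ[𝓝 p] fun q ↦ α (ψ (f q)) (fderiv ℝ (fun q ↦ ψ (f q)) q v) := by
    intro v
    have h1 : ∀ᶠ q in 𝓝 p, f q ∈ ψ.source :=
      hf.continuous.continuousAt.eventually_mem (extChartAt_source_mem_nhds (f p))
    have h2 : ∀ᶠ q in 𝓝 p, ψ (f q) ∈ interior ψ.target :=
      hψfp.continuousAt.eventually_mem hint
    filter_upwards [h1.eventually_nhds, h2] with q hq1 hq2
    have e1 : f =ᶠ[𝓝 q] ψ.symm ∘ fun q ↦ ψ (f q) := by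
      filter_upwards [hq1] with r hr
      exact (ψ.left_inv hr).symm
    have e2 : MDifferentiableAt 𝓘(ℝ, E) I ψ.symm (ψ (f q)) :=
      (hψs.contMDiffAt (isOpen_interior.mem_nhds hq2)).mdifferentiableAt (by simp)
    have e3 : MDifferentiableAt 𝓘(ℝ, W) 𝓘(ℝ, E) (fun q ↦ ψ (f q)) q :=
      MDifferentiableAt.comp (g := ψ) q
        ((contMDiffAt_extChartAt' (n := ∞)
          (by simpa [hψ] using hq1.self_of_nhds)).mdifferentiableAt (by simp))
        (hf.mdifferentiableAt (by simp))
    have e4 := pushforward_comp q e2 e3 v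
    rw [pushforward_eq_fderiv] at e4
    simp only [LieOneForm.component, hα, ContinuousLinearMap.comp_apply]
    rw [pushforward_congr e1, e4, ψ.left_inv hq1.self_of_nhds]
  have hpar : ∀ v, fderiv ℝ (fun q ↦ ψ (f q)) p v =
      pushforward I 𝓘(ℝ, E) ψ (f p) (pushforward 𝓘(ℝ, W) I f p v) := by
    intro v
    rw [← pushforward_eq_fderiv]
    exact pushforward_comp p
      ((contMDiffAt_extChartAt (n := ∞)).mdifferentiableAt (by simp))
      (hf.mdifferentiableAt (by simp)) v
  rw [(hcomp v).fderiv_eq, (hcomp w).fderiv_eq]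
  exact fderiv_form_symm hψfp hαs (by rw [hpar, hv, map_smul]) (by rw [hpar, hw, map_smul])

theorem LieOneForm.component_comp (A : LieOneForm I X J G) {V : Type*} [NormedAddCommGroup V]
    [NormedSpace ℝ V] {f : W → X} (hf : ContMDiff 𝓘(ℝ, W) I ∞ f) {j : V → W} {q v : V}
    (hj : DifferentiableAt ℝ j q) :
    A.component (f ∘ j) v q = A.component f (fderiv ℝ j q v) (j q) := by
  unfold LieOneForm.component
  rw [pushforward_comp q (hf.mdifferentiableAt (by simp)) hj.mdifferentiableAt,
    pushforward_eq_fderiv]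
  rfl

end OneForm

/-! ### Extending a thin homotopy to the plane. -/

section Thin

variable {E : Type*} [NormedAddCommGroup E] [NormedSpace ℝ E]
  {H : Type*} [TopologicalSpace H] {I : ModelWithCorners ℝ E H}
  {X : Type*} [TopologicalSpace X] [ChartedSpace H X]

namespace SittingPath

/-- The extension of a map on the unit square to `ℝ × ℝ`. -/
noncomputable def extendSquare (h : unitInterval × unitInterval → X) (p : ℝ × ℝ) : X :=
  h (projIcc 0 1 zero_le_one p.1, projIcc 0 1 zero_le_one p.2)

theorem coe_projIcc_lt {ε t : ℝ} (hε : 0 < ε) (ht : t < ε) :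
    ((projIcc 0 1 zero_le_one t : unitInterval) : ℝ) < ε := by
  rw [coe_projIcc]
  exact max_lt hε ((min_le_right _ _).trans_lt ht)

theorem lt_coe_projIcc {ε t : ℝ} (hε : 0 < ε) (ht : 1 - ε < t) :
    1 - ε < ((projIcc 0 1 zero_le_one t : unitInterval) : ℝ) := by
  rw [coe_projIcc]
  exact (lt_min (by linarith) ht).trans_le (le_max_right _ _)

theorem pushforward_eq_zero_of_eventually_const {W : Type*} [NormedAddCommGroup W] [NormedSpace ℝ W]
    {f : W → X} {p : W} {c : X} (h : ∀ᶠ q in 𝓝 p, f q = c) (v : W) :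
    pushforward 𝓘(ℝ, W) I f p v = 0 := by
  rw [pushforward_congr (g := fun _ ↦ c) h, pushforward_const]

theorem pushforward_comp_snd {γ : ℝ → X} (hγ : ContMDiff 𝓘(ℝ, ℝ) I ∞ γ) (p : ℝ × ℝ) :
    pushforward 𝓘(ℝ, ℝ × ℝ) I (fun q ↦ γ q.2) p (1, 0) = 0 := by
  have h1 : DifferentiableAt ℝ (Prod.snd : ℝ × ℝ → ℝ) p := differentiableAt_snd
  have := pushforward_comp p (hγ.mdifferentiableAt (by simp)) h1.mdifferentiableAt ((1 : ℝ), (0 : ℝ))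
  rw [pushforward_eq_fderiv, fderiv_snd] at this
  rw [show (fun q : ℝ × ℝ ↦ γ q.2) = γ ∘ Prod.snd from rfl, this]
  simp

/-- The clamping map to [0, 1] is not smooth at 0 and 1, but near and beyond the sides of the square
the extension is constant or depends on t alone through an extended path. The rank hypothesis is
needed only in the interior. -/
theorem IsThinHomotopy.smooth_and_parallel {γ₁ γ₂ : SittingPath I X}
    {h : unitInterval × unitInterval → X} (hh : IsThinHomotopy γ₁ γ₂ h) (p : ℝ × ℝ) :
    ContMDiffAt 𝓘(ℝ, ℝ × ℝ) I ∞ (extendSquare h) p ∧ ∃ (c d : ℝ) (x : E),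
      pushforward 𝓘(ℝ, ℝ × ℝ) I (extendSquare h) p (1, 0) = c • x ∧
      pushforward 𝓘(ℝ, ℝ × ℝ) I (extendSquare h) p (0, 1) = d • x := by
  obtain ⟨ε, hε, -, ht0, ht1, hs0, hs1⟩ := hh.sitting
  have hconst : ∀ c : X, (extendSquare h =ᶠ[𝓝 p] fun _ ↦ c) →
      ContMDiffAt 𝓘(ℝ, ℝ × ℝ) I ∞ (extendSquare h) p ∧ ∃ (c d : ℝ) (x : E),
      pushforward 𝓘(ℝ, ℝ × ℝ) I (extendSquare h) p (1, 0) = c • x ∧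
      pushforward 𝓘(ℝ, ℝ × ℝ) I (extendSquare h) p (0, 1) = d • x := fun c hc ↦
    ⟨contMDiffAt_const.congr_of_eventuallyEq hc, 0, 0, 0,
      by rw [pushforward_eq_zero_of_eventually_const hc, smul_zero],
      by rw [pushforward_eq_zero_of_eventually_const hc, smul_zero]⟩
  have hpath : ∀ γ : SittingPath I X, (extendSquare h =ᶠ[𝓝 p] fun q ↦ γ.extend q.2) →
      ContMDiffAt 𝓘(ℝ, ℝ × ℝ) I ∞ (extendSquare h) p ∧ ∃ (c d : ℝ) (x : E),
      pushforward 𝓘(ℝ, ℝ × ℝ) I (extendSquare h) p (1, 0) = c • x ∧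
      pushforward 𝓘(ℝ, ℝ × ℝ) I (extendSquare h) p (0, 1) = d • x := fun γ hγ ↦
    ⟨(γ.contMDiff_extend.comp contDiff_snd.contMDiff).contMDiffAt.congr_of_eventuallyEq hγ, 0, 1, _,
      by rw [pushforward_congr hγ, pushforward_comp_snd γ.contMDiff_extend, zero_smul],
      (one_smul _ _).symm⟩
  by_cases h1 : p.2 < ε
  · refine hconst (γ₁.toFun 0) ?_
    filter_upwards [(isOpen_lt continuous_snd continuous_const).mem_nhds h1] with q hq
    exact ht0 _ _ (coe_projIcc_lt hε hq)
  by_cases h2 : 1 - ε < p.2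
  · refine hconst (γ₁.toFun 1) ?_
    filter_upwards [(isOpen_lt continuous_const continuous_snd).mem_nhds h2] with q hq
    exact ht1 _ _ (lt_coe_projIcc hε hq)
  by_cases h3 : p.1 < ε
  · refine hpath γ₁ ?_
    filter_upwards [(isOpen_lt continuous_fst continuous_const).mem_nhds h3] with q hq
    exact hs0 _ _ (coe_projIcc_lt hε hq)
  by_cases h4 : 1 - ε < p.1
  · refine hpath γ₂ ?_
    filter_upwards [(isOpen_lt continuous_const continuous_fst).mem_nhds h4] with q hq
    exact hs1 _ _ (lt_coe_projIcc hε hq)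
  have hproj : ∀ t : ℝ, ¬ t < ε → ¬ 1 - ε < t →
      ContMDiffAt 𝓘(ℝ, ℝ) (𝓡∂ 1) ∞ (projIcc (0 : ℝ) 1 zero_le_one) t := fun t h h' ↦
    (contMDiffOn_projIcc t ⟨by linarith, by linarith⟩).contMDiffAt
      (Icc_mem_nhds (by linarith) (by linarith))
  have hφ : ContMDiffAt 𝓘(ℝ, ℝ × ℝ) ((𝓡∂ 1).prod (𝓡∂ 1)) ∞ (fun p : ℝ × ℝ ↦
      ((projIcc 0 1 zero_le_one p.1, projIcc 0 1 zero_le_one p.2) :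
        unitInterval × unitInterval)) p :=
    (ContMDiffAt.comp p (hproj _ h3 h4) contDiff_fst.contMDiff.contMDiffAt).prodMk
      (ContMDiffAt.comp p (hproj _ h1 h2) contDiff_snd.contMDiff.contMDiffAt)
  refine ⟨hh.smooth.contMDiffAt.comp p hφ, ?_⟩
  have hr := hh.rank_le_one (projIcc 0 1 zero_le_one p.1, projIcc 0 1 zero_le_one p.2)
  have hr' : LinearMap.rank (pushforward ((𝓡∂ 1).prod (𝓡∂ 1)) I h
      (projIcc 0 1 zero_le_one p.1, projIcc 0 1 zero_le_one p.2)).toLinearMap ≤ 1 := hr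
  -- Rank at most one gives a single vector x spanning a line that contains the image of the
  -- derivative.
  obtain ⟨x, -, hx⟩ := (rank_submodule_le_one_iff _).1 hr'
  have hc : ∀ v, ∃ c : ℝ, pushforward 𝓘(ℝ, ℝ × ℝ) I (extendSquare h) p v = c • x := by
    intro v
    have e1 := pushforward_comp p (hh.smooth.contMDiffAt.mdifferentiableAt (by simp))
      (hφ.mdifferentiableAt (by simp)) v
    obtain ⟨c, hc⟩ := Submodule.mem_span_singleton.1 (hx (LinearMap.mem_range_self _
      (pushforward 𝓘(ℝ, ℝ × ℝ) ((𝓡∂ 1).prod (𝓡∂ 1)) (fun p : ℝ × ℝ ↦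
      ((projIcc 0 1 zero_le_one p.1, projIcc 0 1 zero_le_one p.2) :
        unitInterval × unitInterval)) p v)))
    exact ⟨c, e1.trans hc.symm⟩
  obtain ⟨c, hc1⟩ := hc (1, 0)
  obtain ⟨d, hd⟩ := hc (0, 1)
  exact ⟨c, d, x, hc1, hd⟩

end SittingPath

end Thin

/-! ### Holonomy and its invariance under thin homotopy. -/

section Holonomy

variable {E : Type*} [NormedAddCommGroup E] [NormedSpace ℝ E]
  {H : Type*} [TopologicalSpace H] {I : ModelWithCorners ℝ E H}
  {X : Type*} [TopologicalSpace X] [ChartedSpace H X] [IsManifold I ∞ X]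
  {E' : Type*} [NormedAddCommGroup E'] [NormedSpace ℝ E'] [FiniteDimensional ℝ E']
  {H' : Type*} [TopologicalSpace H'] {J : ModelWithCorners ℝ E' H'}
  {G : Type*} [TopologicalSpace G] [ChartedSpace H' G] [Group G] [LieGroup J ∞ G]
  [BoundarylessManifold J G] [T2Space G]

omit [FiniteDimensional ℝ E'] [BoundarylessManifold J G] [T2Space G] [LieGroup J ∞ G] in
theorem IsPathOrderedSolution.isRightSolutionAt {A : LieOneForm I X J G} {c : ℝ → X}
    {hc : ContMDiff 𝓘(ℝ, ℝ) I ∞ c} {t₀ : ℝ} {u : ℝ → G}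
    (hu : IsPathOrderedSolution (A.pullback c hc) t₀ u) (t : ℝ) :
    IsRightSolutionAt J (A.component c (1 : ℝ)) u t := by
  have h1 := hasVelocityAt_pushforward (I := J) (hu.smooth.mdifferentiableAt (x := t) (by simp))
  have h2 : pushforward 𝓘(ℝ, ℝ) J u t 1 =
      -pushforward J J (fun g : G ↦ g * u t) 1 (A.component c (1 : ℝ) t) := hu.deriv t
  rwa [h2] at h1

omit [FiniteDimensional ℝ E'] [T2Space G] in
theorem isPathOrderedSolution_of_isRightSolutionAt {A : LieOneForm I X J G} {c : ℝ → X}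
    {hc : ContMDiff 𝓘(ℝ, ℝ) I ∞ c} {t₀ : ℝ} {u : ℝ → G} (hu0 : u t₀ = 1)
    (hu : ∀ t, IsRightSolutionAt J (A.component c (1 : ℝ)) u t) :
    IsPathOrderedSolution (A.pullback c hc) t₀ u where
  smooth := contMDiff_right_solution (A.contDiff_component hc 1) hu
  deriv t := (hu t).pushforward_one
  initial := hu0

theorem existsUnique_isPathOrderedSolution (A : LieOneForm I X J G) (γ : SittingPath I X) :
    ∃! u : ℝ → G, IsPathOrderedSolution (A.pullback γ.extend γ.contMDiff_extend) 0 u := by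
  have hb := A.contDiff_component γ.contMDiff_extend (1 : ℝ)
  have hb0 : ∀ t ∉ Icc (0 : ℝ) 1, A.component γ.extend (1 : ℝ) t = 0 := by
    intro t ht
    -- Outside [0, 1] the extended path is locally constant, so the coefficient vanishes there.
    have : ∃ c, ∀ᶠ r in 𝓝 t, γ.extend r = c := by
      by_cases h : t < 0
      · refine ⟨γ.toFun 0, ?_⟩
        filter_upwards [Iio_mem_nhds h] with r hr
        exact congrArg γ.toFun (projIcc_of_le_left _ (le_of_lt hr))
      · refine ⟨γ.toFun 1, ?_⟩
        filter_upwards [Ioi_mem_nhds (show 1 < t by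
          by_contra h'; exact ht ⟨not_lt.1 h, not_lt.1 h'⟩)] with r hr
        exact congrArg γ.toFun (projIcc_of_right_le _ (le_of_lt hr))
    obtain ⟨c, hc⟩ := this
    rw [LieOneForm.component, SittingPath.pushforward_eq_zero_of_eventually_const hc, map_zero]
  obtain ⟨u, hu0, hu⟩ := exists_right_solution (J := J) (G := G) hb hb0
  refine ⟨u, isPathOrderedSolution_of_isRightSolutionAt hu0 hu, fun u' hu' ↦ ?_⟩
  exact isRightSolution_unique hb hu'.isRightSolutionAt hu (hu'.initial.trans hu0.symm)

theorem pathHolonomy_eq_of_isRightSolutionAt {A : LieOneForm I X J G} {γ : SittingPath I X}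
    {u : ℝ → G} (hu0 : u 0 = 1)
    (hu : ∀ t, IsRightSolutionAt J (A.component γ.extend (1 : ℝ)) u t) :
    pathHolonomy A γ = u 1 := by
  have h := existsUnique_isPathOrderedSolution A γ
  rw [pathHolonomy, pathOrderedExp, dif_pos h.exists]
  exact congrFun (h.unique h.exists.choose_spec
    (isPathOrderedSolution_of_isRightSolutionAt hu0 hu)) 1

theorem pathHolonomy_eq_of_thinHomotopic [BoundarylessManifold I X] (A : LieOneForm I X J G)
    {γ₁ γ₂ : SittingPath I X} (hγ : SittingPath.ThinHomotopic γ₁ γ₂) :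
    pathHolonomy A γ₁ = pathHolonomy A γ₂ := by
  obtain ⟨-, -, h, hh⟩ := hγ
  set f := SittingPath.extendSquare h with hf
  have hfs : ContMDiff 𝓘(ℝ, ℝ × ℝ) I ∞ f := fun p ↦ (hh.smooth_and_parallel p).1
  have hpar := fun p ↦ (hh.smooth_and_parallel p).2
  obtain ⟨ε, hε, -, ht0, ht1, hs0, hs1⟩ := hh.sitting
  have hzero : ∀ s t : ℝ, (t < ε ∨ 1 - ε < t) → ∀ v, A.component f v (s, t) = 0 := by
    intro s t ht v
    have : ∃ c, ∀ᶠ q in 𝓝 (s, t), f q = c := by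
      rcases ht with ht | ht
      · refine ⟨γ₁.toFun 0, ?_⟩
        filter_upwards [(isOpen_lt continuous_snd continuous_const).mem_nhds
          (show (s, t).2 < ε from ht)] with q hq
        exact ht0 _ _ (SittingPath.coe_projIcc_lt hε hq)
      · refine ⟨γ₁.toFun 1, ?_⟩
        filter_upwards [(isOpen_lt continuous_const continuous_snd).mem_nhds
          (show 1 - ε < (s, t).2 from ht)] with q hq
        exact ht1 _ _ (SittingPath.lt_coe_projIcc hε hq)
    obtain ⟨c, hc⟩ := this
    rw [LieOneForm.component, SittingPath.pushforward_eq_zero_of_eventually_const hc, map_zero]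
  have ha := A.contDiff_component hfs ((1 : ℝ), (0 : ℝ))
  have hB := A.contDiff_component hfs ((0 : ℝ), (1 : ℝ))
  have hex : ∀ s : ℝ, ∃ u : ℝ → G, u 0 = 1 ∧
      ∀ t, IsRightSolutionAt J (fun t ↦ A.component f ((0 : ℝ), (1 : ℝ)) (s, t)) u t := by
    refine fun s ↦ exists_right_solution (hB.comp (contDiff_const.prodMk contDiff_id))
      fun t ht ↦ hzero s t ?_ _
    by_contra h'
    push Not at h'
    exact ht ⟨by linarith [h'.1], by linarith [h'.2]⟩
  -- Solutions are chosen slice by slice, with no regularity in s.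
  choose u hu0 hu using hex
  have hslice : ∀ (s : ℝ) (γ : SittingPath I X), (∀ t, f (s, t) = γ.extend t) →
      pathHolonomy A γ = u s 1 := by
    intro s γ hγ
    refine pathHolonomy_eq_of_isRightSolutionAt (hu0 s) ?_
    have e1 : γ.extend = f ∘ fun t ↦ (s, t) := funext fun t ↦ (hγ t).symm
    have e2 : A.component γ.extend (1 : ℝ) =
        fun t ↦ A.component f ((0 : ℝ), (1 : ℝ)) (s, t) := by
      ext t
      have hj := hasFDerivAt_prodMk_right (𝕜 := ℝ) s t
      rw [e1, A.component_comp hfs hj.differentiableAt, hj.fderiv]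
      rfl
    rw [e2]
    exact hu s
  rw [hslice 0 γ₁ fun t ↦ hs0 _ _ (SittingPath.coe_projIcc_lt hε hε),
    hslice 1 γ₂ fun t ↦ hs1 _ _ (SittingPath.lt_coe_projIcc hε (by linarith))]
  refine right_solution_eq_of_flat ha hB (fun p ↦ ?_) (fun p ↦ ?_)
    (fun s ↦ hzero s 0 (Or.inl hε) _) (fun s ↦ hzero s 1 (Or.inr (by linarith)) _) hu0 hu 0 1
  · obtain ⟨c, d, x, h1, h2⟩ := hpar p
    exact A.fderiv_component_symm hfs h1 h2
  · obtain ⟨c, d, x, h1, h2⟩ := hpar p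
    refine ⟨c, d, A.eval (f p) x, ?_, ?_⟩
    · rw [LieOneForm.component, h1, map_smul]
    · rw [LieOneForm.component, h2, map_smul]

end Holonomy

end

theorem mainTheorem11
    {E : Type*} [NormedAddCommGroup E] [NormedSpace ℝ E] [FiniteDimensional ℝ E]
    {H : Type*} [TopologicalSpace H] (I : ModelWithCorners ℝ E H)
    (X : Type*) [TopologicalSpace X] [ChartedSpace H X] [IsManifold I ∞ X]
    [BoundarylessManifold I X]
    {E' : Type*} [NormedAddCommGroup E'] [NormedSpace ℝ E'] [FiniteDimensional ℝ E']
    {H' : Type*} [TopologicalSpace H'] (J : ModelWithCorners ℝ E' H')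
    (G : Type*) [TopologicalSpace G] [ChartedSpace H' G] [Group G] [LieGroup J ∞ G]
    [BoundarylessManifold J G] [T2Space G]
    (A : LieOneForm I X J G) :
    (∀ γ : SittingPath I X, ∃! u : ℝ → G,
      IsPathOrderedSolution (A.pullback γ.extend γ.contMDiff_extend) 0 u) ∧
    ∃! F : ThinPathClass I X → G, pathHolonomy A = F ∘ SittingPath.pr := by
  refine ⟨existsUnique_isPathOrderedSolution A,
    Quotient.lift (pathHolonomy A) fun _ _ h ↦ pathHolonomy_eq_of_thinHomotopic A h, rfl, ?_⟩
  intro F hF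
  ext q
  induction q using Quotient.inductionOn with
  | h γ => exact (congrFun hF γ).symm
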